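/- For a polynomial $P\in\mathbb Z[X]$ let $H(P)$ be the maximum of the absolute values of its coefficients; for an algebraic number $\alpha\in\mathbb C$ let $H(\alpha)$ be the height of its minimal polynomial over $\mathbb Z$. For a real number $\xi$ and an integer $n\ge 1$ let $w_n(\xi)\in[-\infty,+\infty]$ (resp. $w_n^*(\xi)$) be the supremum of the real numbers $w$ (resp. $w^*$) for which $$0<|P(\xi)|\le H(P)^{-w}\qquad(\text{resp. } 0<|\xi-\alpha|\le H(\alpha)^{-w^*-1})$$ holds for infinitely many $P\in\mathbb Z[X]$ of degree at most $n$ (resp. infinitely many algebraic numbers $\alpha\in\mathbb C$ of degree at most $n$). **Theorem.** Let $d\ge 2$ be an integer, let $w\ge 121d^2$ be a real number, and let $a,b,c$ be distinct positive integers. Let $0<\eta<\sqrt w/d$ and, for $i\ge 1$, put $$m_i:=\left\lfloor\frac{\lfloor w^{i+1}\rfloor-\lfloor w^i-1\rfloor}{\lfloor\eta w^i\rfloor}\right\rfloor ,$$ with $m_i:=0$ for the (finitely many) $i$ with $\lfloor\eta w^i\rfloor=0$. Let $(a_{n,w,\eta})_{n\ge 1}$ be the sequence given by $$a_{n,w,\eta}=\begin{cases}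 b & \text{if } n=\lfloor w^i\rfloor\text{ for some integer } i\ge 0,\\ c & \text{if } n\ne\lfloor w^i\rfloor\text{ for all integers } i\ge 0\text{, and } n=\lfloor w^j\rfloor+m\lfloor\eta w^j\rfloor\text{ for some integers } j\ge 1,\ 1\le m\le m_j,\\ a & \text{otherwise.}\end{cases}$$ Then the continued fraction $\xi_{w,\eta}:=[0,a_{1,w,\eta},a_{2,w,\eta},\ldots]$ converges to a real number, and for all integers $n$ with $2\le n\le d$, $$w_n^*(\xi_{w,\eta})=\frac{2w-2-\eta}{2+\eta},\qquad w_n(\xi_{w,\eta})=\frac{2w-\eta}{2+\eta},\qquad w_n(\xi_{w,\eta})-w_n^*(\xi_{w,\eta})=\frac{2}{2+\eta}.$$ -/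

import Mathlib

open Filter Topology Polynomial

/-- The (naive) height of an integer polynomial: the maximum of the absolute values of its
coefficients. -/
def polyHeight (P : ℤ[X]) : ℕ := P.support.sup fun i => (P.coeff i).natAbs

/-- The minimal polynomial over `ℤ` of an algebraic number `α`: the primitive integer polynomial
proportional to the minimal polynomial of `α` over `ℚ`. It is determined up to sign, and the sign
does not affect its height. -/
noncomputable def intMinpoly (α : ℂ) : ℤ[X] :=
  (IsLocalization.integerNormalization (nonZeroDivisors ℤ) (minpoly ℚ α)).primPart

/-- The height of an algebraic number. -/
noncomputable def algHeight (α : ℂ) : ℕ := polyHeight (intMinpoly α)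

/-- The exponent `w_n(ξ)`, as an extended real number. -/
noncomputable def wExp (n : ℕ) (ξ : ℝ) : EReal :=
  sSup ((fun w : ℝ => (w : EReal)) '' {w : ℝ | Set.Infinite {P : ℤ[X] | P.natDegree ≤ n ∧
    0 < |aeval ξ P| ∧ |aeval ξ P| ≤ (polyHeight P : ℝ) ^ (-w)}})

/-- The exponent `w_n^*(ξ)`, as an extended real number. -/
noncomputable def wStarExp (n : ℕ) (ξ : ℝ) : EReal :=
  sSup ((fun w : ℝ => (w : EReal)) '' {w : ℝ | Set.Infinite {α : ℂ | IsAlgebraic ℚ α ∧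
    (minpoly ℚ α).natDegree ≤ n ∧
    0 < ‖(ξ : ℂ) - α‖ ∧ ‖(ξ : ℂ) - α‖ ≤ (algHeight α : ℝ) ^ (-w - 1)}})

/-- `m_i = ⌊(⌊w^(i+1)⌋ - ⌊w^i - 1⌋) / ⌊η w^i⌋⌋`. For the finitely many `i` with `⌊η w^i⌋ = 0` this
is `0`. -/
noncomputable def mBound (w η : ℝ) (i : ℕ) : ℤ :=
  ⌊((⌊w ^ (i + 1)⌋ : ℝ) - (⌊w ^ i - 1⌋ : ℝ)) / (⌊η * w ^ i⌋ : ℝ)⌋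

open Classical in
/-- The partial quotient `a_{n,w,η}`, for `n ≥ 1`. -/
noncomputable def partQuot (w η : ℝ) (a b c : ℕ) (n : ℕ) : ℕ :=
  if ∃ i : ℕ, (n : ℤ) = ⌊w ^ i⌋ then b
  else if ∃ j : ℕ, 1 ≤ j ∧ ∃ m : ℤ, 1 ≤ m ∧ m ≤ mBound w η j ∧
      (n : ℤ) = ⌊w ^ j⌋ + m * ⌊η * w ^ j⌋ then c
  else a

/-- The infinite simple continued fraction `[0, q 1, q 2, q 3, …]`. -/
noncomputable def simpleCF (q : ℕ → ℕ) : GenContFract ℝ where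
  h := 0
  s := Stream'.Seq.ofStream fun k => ⟨1, (q (k + 1) : ℝ)⟩

/-! Between positions `⌊w^j⌋` and `⌊w^(j+1)⌋` the partial quotients are periodic with period `ℓ = ⌊η
w^j⌋`, up to at most one index at the start (`partQuot_structure`). Continuing that period forever
gives a quadratic irrational `α_j` agreeing with `ξ` up to position `⌊w^(j+1)⌋ - 1`. Only `O(J)` of
the first `⌊w^J⌋` partial quotients differ from `a`, so the logarithm of the `n`-th denominator is
`n log θ` up to an error linear in `J`, where `θ^2 = a θ + 1` (`abs_log_cfDen_sub_le`). Put `T = w^j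
log θ`. If the period runs from `r + 1` to `s = r + ℓ`, and `R = ⌊w^(j+1)⌋`, then up to `e^(o(T))`:
the quadratic polynomial `Q = cfWedge x r s` of `α_j` has height `q_r q_s = e^((2+η)T)`; `|ξ - α_j|
= q_R^(-2) = e^(-2wT)`; `|Q(ξ)| = q_s / (q_r q_R^2) = e^(-(2w-η)T)`. The content of `Q` divides `c -
a`, so the minimal polynomial of `α_j` obeys the same estimates. Dividing exponents gives both lower
bounds. The two exponents differ because the conjugate of `α_j` is itself near `ξ`, at distance
about `e^(-2T)`.

For the upper bounds, let `P` be irreducible of degree at most `d` and not associated to any of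
these minimal polynomials. The resultant with the minimal polynomial of `α_j` is a nonzero integer,
so `P(α_j)` is not too small (`one_le_norm_aeval_mul`); if `j` suits the height of `P`, then `α_j`
is so close to `ξ` that `P(ξ)` inherits the bound (`exists_le_aeval_of_not_associated`). As `w` is
large compared with `d(2+η)^2`, the resulting exponent does not exceed that of `α_j`, so the `α_j`
are optimal. Multiplicativity of the Mahler measure passes to reducible polynomials
(`le_abs_aeval_of_irreducible`), and `IsQuadApprox.le_dist_root` rules out that the conjugate of
`α_j` is closer to `ξ` than the estimate for `α_j` allows. -/

/-! ### Continuants and the value of a continued fraction -/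

/-- Numerators of the convergents of `[0; x 1, x 2, …]`, shifted by one: the index `n + 1` carries
the usual `n`-th numerator. -/
def cfNum (x : ℕ → ℕ) : ℕ → ℤ
  | 0 => 1
  | 1 => 0
  | n + 2 => x (n + 1) * cfNum x (n + 1) + cfNum x n

/-- Denominators of the convergents of `[0; x 1, x 2, …]`, shifted by one. -/
def cfDen (x : ℕ → ℕ) : ℕ → ℤ
  | 0 => 0
  | 1 => 1
  | n + 2 => x (n + 1) * cfDen x (n + 1) + cfDen x n

theorem cfNum_add_two (x : ℕ → ℕ) (n : ℕ) :
    cfNum x (n + 2) = x (n + 1) * cfNum x (n + 1) + cfNum x n := rfl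

theorem cfDen_add_two (x : ℕ → ℕ) (n : ℕ) :
    cfDen x (n + 2) = x (n + 1) * cfDen x (n + 1) + cfDen x n := rfl

theorem cf_det (x : ℕ → ℕ) (n : ℕ) :
    cfNum x (n + 1) * cfDen x n - cfNum x n * cfDen x (n + 1) = (-1) ^ (n + 1) := by
  induction n with
  | zero => simp [cfNum, cfDen]
  | succ n ih => rw [cfNum_add_two, cfDen_add_two, pow_succ, ← ih]; ring

theorem cfNum_add (x : ℕ → ℕ) (N m : ℕ) :
    cfNum x (N + m) = cfNum x (N + 1) * cfDen (fun i => x (N + i)) m +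
      cfNum x N * cfNum (fun i => x (N + i)) m := by
  induction m using Nat.twoStepInduction with
  | zero => simp [cfNum, cfDen]
  | one => simp [cfNum, cfDen]
  | more m h1 h2 =>
    rw [show N + (m + 2) = (N + m) + 2 by ring, cfNum_add_two, cfNum_add_two, cfDen_add_two, h1,
      show N + m + 1 = N + (m + 1) by ring, h2]
    ring

theorem cfDen_add (x : ℕ → ℕ) (N m : ℕ) :
    cfDen x (N + m) = cfDen x (N + 1) * cfDen (fun i => x (N + i)) m +
      cfDen x N * cfNum (fun i => x (N + i)) m := by
  induction m using Nat.twoStepInduction with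
  | zero => simp [cfNum, cfDen]
  | one => simp [cfNum, cfDen]
  | more m h1 h2 =>
    rw [show N + (m + 2) = (N + m) + 2 by ring, cfDen_add_two, cfNum_add_two, cfDen_add_two, h1,
      show N + m + 1 = N + (m + 1) by ring, h2]
    ring

theorem cf_congr {x y : ℕ → ℕ} {N : ℕ} (h : ∀ i, 1 ≤ i → i ≤ N → x i = y i) (n : ℕ)
    (hn : n ≤ N + 1) : cfNum x n = cfNum y n ∧ cfDen x n = cfDen y n := by
  induction n using Nat.twoStepInduction with
  | zero => simp [cfNum, cfDen]
  | one => simp [cfNum, cfDen]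
  | more m h1 h2 =>
    rw [cfNum_add_two, cfNum_add_two, cfDen_add_two, cfDen_add_two, (h1 (by omega)).1,
      (h1 (by omega)).2, (h2 (by omega)).1, (h2 (by omega)).2, h (m + 1) (by omega) (by omega)]
    exact ⟨rfl, rfl⟩

theorem cfNum_nonneg (x : ℕ → ℕ) (n : ℕ) : 0 ≤ cfNum x n := by
  induction n using Nat.twoStepInduction with
  | zero => simp [cfNum]
  | one => simp [cfNum]
  | more n h1 h2 => rw [cfNum_add_two]; positivity

theorem cfDen_nonneg_and_pos {x : ℕ → ℕ} (hx : ∀ n, 0 < x n) (n : ℕ) :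
    0 ≤ cfDen x n ∧ 0 < cfDen x (n + 1) := by
  induction n with
  | zero => simp [cfDen]
  | succ n ih =>
    refine ⟨ih.2.le, ?_⟩
    rw [cfDen_add_two]
    have : (0 : ℤ) < x (n + 1) := by exact_mod_cast hx _
    nlinarith [mul_pos this ih.2, ih.1]

theorem cfDen_nonneg {x : ℕ → ℕ} (hx : ∀ n, 0 < x n) (n : ℕ) :
    0 ≤ cfDen x n := (cfDen_nonneg_and_pos hx n).1

theorem cfDen_succ_pos {x : ℕ → ℕ} (hx : ∀ n, 0 < x n) (n : ℕ) :
    0 < cfDen x (n + 1) := (cfDen_nonneg_and_pos hx n).2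

theorem cfDen_le_succ {x : ℕ → ℕ} (hx : ∀ n, 0 < x n) (n : ℕ) : cfDen x n ≤ cfDen x (n + 1) := by
  cases n with
  | zero => simp [cfDen]
  | succ n =>
    rw [cfDen_add_two]
    have : (1 : ℤ) ≤ x (n + 1) := by exact_mod_cast hx _
    nlinarith [cfDen_succ_pos hx n, cfDen_nonneg hx n]

theorem le_cfDen_succ {x : ℕ → ℕ} (hx : ∀ n, 0 < x n) (n : ℕ) : (n : ℤ) ≤ cfDen x (n + 1) := by
  induction n using Nat.twoStepInduction with
  | zero => simp [cfDen]
  | one =>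
    have : (1 : ℤ) ≤ x 1 := by exact_mod_cast hx _
    simpa [cfDen] using this
  | more n _ ih =>
    rw [cfDen_add_two]
    have : (1 : ℤ) ≤ x (n + 2) := by exact_mod_cast hx _
    have h1 := cfDen_succ_pos hx n
    have h2 := cfDen_succ_pos hx (n + 1)
    push_cast at ih ⊢
    nlinarith

theorem cfNum_le_cfDen {x : ℕ → ℕ} (hx : ∀ n, 0 < x n) (n : ℕ) :
    cfNum x (n + 1) ≤ cfDen x (n + 1) := by
  induction n using Nat.twoStepInduction with
  | zero => simp [cfNum, cfDen]
  | one =>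
    have : (1 : ℤ) ≤ x 1 := by exact_mod_cast hx _
    simpa [cfNum, cfDen] using this
  | more n h1 h2 =>
    rw [cfNum_add_two, cfDen_add_two]
    have : (0 : ℤ) ≤ x (n + 2) := by positivity
    nlinarith

/-- By the determinant identity consecutive convergents differ by the reciprocal of a product of two
denominators, which grow at least linearly; the differences are therefore summable. -/
theorem exists_tendsto_cf {x : ℕ → ℕ} (hx : ∀ n, 0 < x n) :
    ∃ v : ℝ, Tendsto (fun n => (cfNum x n : ℝ) / cfDen x n) atTop (𝓝 v) := by
  have hc : CauchySeq (fun n => (cfNum x (n + 2) : ℝ) / cfDen x (n + 2)) := by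
    apply cauchySeq_of_summable_dist
    refine Summable.of_nonneg_of_le (fun _ => dist_nonneg) (fun n => ?_)
      ((summable_nat_add_iff 1).mpr (Real.summable_one_div_nat_pow.mpr one_lt_two))
    have hd2 : (0 : ℝ) < cfDen x (n + 2) := by exact_mod_cast cfDen_succ_pos hx (n + 1)
    have hd3 : (0 : ℝ) < cfDen x (n + 3) := by exact_mod_cast cfDen_succ_pos hx (n + 2)
    have hl : ((n : ℝ) + 1) ≤ cfDen x (n + 2) := by exact_mod_cast le_cfDen_succ hx (n + 1)
    have hl' : ((n : ℝ) + 1) ≤ cfDen x (n + 3) :=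
      hl.trans (by exact_mod_cast cfDen_le_succ hx (n + 2))
    have hdet : (cfNum x (n + 3) : ℝ) * cfDen x (n + 2) - cfNum x (n + 2) * cfDen x (n + 3) =
      (-1) ^ (n + 3) := by exact_mod_cast cf_det x (n + 2)
    rw [Real.dist_eq, show n + 1 + 2 = n + 3 by ring, abs_sub_comm,
      div_sub_div _ _ hd3.ne' hd2.ne', mul_comm (cfDen x (n + 3) : ℝ), hdet, abs_div, abs_pow,
      abs_neg, abs_one, one_pow, abs_of_pos (by positivity)]
    push_cast
    apply one_div_le_one_div_of_le (by positivity)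
    rw [sq]
    gcongr
  obtain ⟨v, hv⟩ := cauchySeq_tendsto_of_complete hc
  exact ⟨v, (tendsto_add_atTop_iff_nat 2).mp hv⟩

/-- The value of the infinite continued fraction `[0; x 1, x 2, …]`. -/
noncomputable def cfVal (x : ℕ → ℕ) : ℝ :=
  limUnder atTop (fun n => (cfNum x n : ℝ) / cfDen x n)

theorem contsAux_simpleCF (x : ℕ → ℕ) (n : ℕ) :
    (simpleCF x).contsAux n = ⟨(cfNum x n : ℝ), (cfDen x n : ℝ)⟩ := by
  induction n using Nat.twoStepInduction with
  | zero => simp [cfNum, cfDen, GenContFract.contsAux]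
  | one => simp [cfNum, cfDen, GenContFract.contsAux, simpleCF]
  | more n h1 h2 =>
    rw [GenContFract.contsAux_recurrence (gp := ⟨1, (x (n + 1) : ℝ)⟩) rfl h1 h2, cfNum_add_two,
      cfDen_add_two]
    push_cast
    simp

theorem tendsto_cfVal {x : ℕ → ℕ} (hx : ∀ n, 0 < x n) :
    Tendsto (fun n => (cfNum x n : ℝ) / cfDen x n) atTop (𝓝 (cfVal x)) :=
  tendsto_nhds_limUnder (exists_tendsto_cf hx)

theorem tendsto_convs_simpleCF {x : ℕ → ℕ} (hx : ∀ n, 0 < x n) :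
    Tendsto (fun k => (simpleCF x).convs k) atTop (𝓝 (cfVal x)) := by
  refine ((tendsto_add_atTop_iff_nat 1).mpr (tendsto_cfVal hx)).congr fun k => ?_
  rw [GenContFract.conv_eq_conts_a_div_conts_b, GenContFract.nth_cont_eq_succ_nth_contAux,
    contsAux_simpleCF]

theorem cfVal_nonneg {x : ℕ → ℕ} (hx : ∀ n, 0 < x n) : 0 ≤ cfVal x := by
  refine ge_of_tendsto' (tendsto_cfVal hx) fun n => div_nonneg ?_ ?_
  · exact_mod_cast cfNum_nonneg x n
  · exact_mod_cast cfDen_nonneg hx n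

theorem cfVal_le_one {x : ℕ → ℕ} (hx : ∀ n, 0 < x n) : cfVal x ≤ 1 := by
  refine le_of_tendsto' ((tendsto_add_atTop_iff_nat 1).mpr (tendsto_cfVal hx)) fun n => ?_
  rw [div_le_one (by exact_mod_cast cfDen_succ_pos hx n)]
  exact_mod_cast cfNum_le_cfDen hx n

/-- The value is the Möbius image of its tail under the matrix of continuants. The denominator-free
form also makes sense at `N = 0`. -/
theorem cfVal_tail_mul {x : ℕ → ℕ} (hx : ∀ n, 0 < x n) (N : ℕ) :
    cfVal x * (cfDen x (N + 1) + cfDen x N * cfVal (fun i => x (N + i))) =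
      cfNum x (N + 1) + cfNum x N * cfVal (fun i => x (N + i)) := by
  have hy : ∀ n, 0 < (fun i => x (N + i)) n := fun n => hx _
  have h1 := (tendsto_cfVal hy)
  have h2 := (tendsto_add_atTop_iff_nat N).mpr (tendsto_cfVal hx)
  have h3 := h2.mul ((tendsto_const_nhds (x := (cfDen x (N + 1) : ℝ))).add
    ((tendsto_const_nhds (x := (cfDen x N : ℝ))).mul h1))
  have h4 := (tendsto_const_nhds (x := (cfNum x (N + 1) : ℝ))).add
    ((tendsto_const_nhds (x := (cfNum x N : ℝ))).mul h1)
  refine tendsto_nhds_unique h3 (h4.congr' ?_)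
  filter_upwards [eventually_ge_atTop 1] with m hm
  obtain ⟨m, rfl⟩ := Nat.exists_eq_add_of_le' hm
  have hd : (0 : ℝ) < cfDen (fun i => x (N + i)) (m + 1) := by
    exact_mod_cast cfDen_succ_pos hy m
  have hD : (0 : ℝ) < cfDen x (N + (m + 1)) := by
    exact_mod_cast cfDen_succ_pos hx (N + m)
  have e1 : (cfNum x (N + (m + 1)) : ℝ) = _ := congrArg Int.cast (cfNum_add x N (m + 1))
  have e2 : (cfDen x (N + (m + 1)) : ℝ) = _ := congrArg Int.cast (cfDen_add x N (m + 1))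
  push_cast at e1 e2
  rw [show m + 1 + N = N + (m + 1) by ring]
  field_simp
  rw [e1, e2]
  ring

theorem cfVal_mul_head {x : ℕ → ℕ} (hx : ∀ n, 0 < x n) :
    cfVal x * (x 1 + cfVal (fun i => x (1 + i))) = 1 := by
  have := cfVal_tail_mul hx 1
  simpa [cfNum, cfDen] using this

theorem cfVal_pos {x : ℕ → ℕ} (hx : ∀ n, 0 < x n) : 0 < cfVal x := by
  refine (cfVal_nonneg hx).lt_of_ne fun h => ?_
  have := cfVal_mul_head hx
  rw [← h] at this
  simp at this

/-! ### Distance between continued fractions with bounded partial quotients -/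

theorem inv_succ_le_of_mul_add_eq_one {K m : ℕ} {v t : ℝ} (hm : m ≤ K) (h0 : 0 ≤ v)
    (ht1 : t ≤ 1) (h : v * (m + t) = 1) : 1 / ((K : ℝ) + 1) ≤ v := by
  have : (m : ℝ) ≤ K := by exact_mod_cast hm
  rw [div_le_iff₀ (by positivity)]
  nlinarith

theorem le_of_mul_add_eq_one {K m : ℕ} {v t : ℝ} (hm : 0 < m) (h0 : 0 ≤ v)
    (ht : 1 / ((K : ℝ) + 1) ≤ t) (h : v * (m + t) = 1) : v ≤ 1 - 1 / ((K : ℝ) + 2) := by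
  have : (1 : ℝ) ≤ m := by exact_mod_cast hm
  have hK : (0 : ℝ) ≤ K := by positivity
  have e : (1 - 1 / ((K : ℝ) + 2)) = (K + 1) / (K + 2) := by field_simp; ring
  rw [e, le_div_iff₀ (by positivity)]
  have h1 : v * (1 + 1 / ((K : ℝ) + 1)) ≤ 1 :=
    (mul_le_mul_of_nonneg_left (add_le_add this ht) h0).trans h.le
  have h2 : v * (1 + 1 / ((K : ℝ) + 1)) = v * (K + 2) / (K + 1) := by field_simp; ring
  rw [h2, div_le_one (by positivity)] at h1
  exact h1

/-- Tails merely in `[0, 1]` would not do, as `m + 1 = (m + 1) + 0`. Bounded partial quotients keep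
tails away from `1`, and that margin is the gap. -/
theorem inv_le_abs_add_sub_add {K m n : ℕ} {t t' : ℝ} (hmn : m ≠ n) (h0 : 0 ≤ t) (h0' : 0 ≤ t')
    (ht : t ≤ 1 - 1 / ((K : ℝ) + 2)) (ht' : t' ≤ 1 - 1 / ((K : ℝ) + 2)) :
    1 / ((K : ℝ) + 2) ≤ |(m + t) - (n + t')| := by
  rcases lt_or_gt_of_ne hmn with h | h
  · have : (m : ℝ) + 1 ≤ n := by exact_mod_cast h
    rw [abs_sub_comm]
    exact le_trans (by linarith) (le_abs_self _)
  · have : (n : ℝ) + 1 ≤ m := by exact_mod_cast h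
    exact le_trans (by linarith) (le_abs_self _)

/-- A lower bound for the distance between two continued fractions with partial quotients at most
`K` and distinct first partial quotients. -/
noncomputable def cfGap (K : ℕ) : ℝ := 1 / (((K : ℝ) + 1) ^ 2 * (K + 2))

theorem cfGap_pos (K : ℕ) : 0 < cfGap K := by unfold cfGap; positivity

theorem cfVal_ge {x : ℕ → ℕ} (hx : ∀ n, 0 < x n) {K : ℕ} (hK : ∀ n, x n ≤ K) :
    1 / ((K : ℝ) + 1) ≤ cfVal x :=
  inv_succ_le_of_mul_add_eq_one (hK 1) (cfVal_nonneg hx) (cfVal_le_one fun _ => hx _)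
    (cfVal_mul_head hx)

theorem cfVal_le {x : ℕ → ℕ} (hx : ∀ n, 0 < x n) {K : ℕ} (hK : ∀ n, x n ≤ K) :
    cfVal x ≤ 1 - 1 / ((K : ℝ) + 2) :=
  le_of_mul_add_eq_one (hx 1) (cfVal_nonneg hx) (cfVal_ge (fun _ => hx _) fun _ => hK _)
    (cfVal_mul_head hx)

theorem cfGap_le_abs_cfVal_sub {x y : ℕ → ℕ} (hx : ∀ n, 0 < x n) (hy : ∀ n, 0 < y n) {K : ℕ}
    (hxK : ∀ n, x n ≤ K) (hyK : ∀ n, y n ≤ K) (h : x 1 ≠ y 1) :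
    cfGap K ≤ |cfVal x - cfVal y| := by
  set t := cfVal (fun i => x (1 + i)) with ht
  set t' := cfVal (fun i => y (1 + i)) with ht'
  have hv : cfVal x * (x 1 + t) = 1 := cfVal_mul_head hx
  have hv' : cfVal y * (y 1 + t') = 1 := cfVal_mul_head hy
  have key : cfVal x - cfVal y = cfVal x * cfVal y * ((y 1 + t') - (x 1 + t)) := by
    linear_combination cfVal y * hv - cfVal x * hv'
  have h1 := inv_le_abs_add_sub_add (K := K) h.symm
    (cfVal_nonneg (x := fun i => y (1 + i)) fun _ => hy _)
    (cfVal_nonneg (x := fun i => x (1 + i)) fun _ => hx _)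
    (cfVal_le (fun _ => hy _) fun _ => hyK _) (cfVal_le (fun _ => hx _) fun _ => hxK _)
  rw [key, abs_mul, abs_mul, abs_of_pos (cfVal_pos hx), abs_of_pos (cfVal_pos hy)]
  calc cfGap K = 1 / ((K : ℝ) + 1) * (1 / ((K : ℝ) + 1)) * (1 / ((K : ℝ) + 2)) := by
        unfold cfGap; field_simp
    _ ≤ _ := by
        have hxv := cfVal_pos hx
        have hyv := cfVal_pos hy
        gcongr
        · exact cfVal_ge hx hxK
        · exact cfVal_ge hy hyK

/-- Both numbers are images of their tails under one Möbius map of determinant `±1`, so their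
difference is that of the tails divided by the two denominators. -/
theorem abs_cfVal_sub_mul {x y : ℕ → ℕ} (hx : ∀ n, 0 < x n) (hy : ∀ n, 0 < y n) {N : ℕ}
    (h : ∀ i, 1 ≤ i → i ≤ N → x i = y i) :
    |cfVal x - cfVal y| * ((cfDen x (N + 1) + cfDen x N * cfVal (fun i => x (N + i))) *
      (cfDen x (N + 1) + cfDen x N * cfVal (fun i => y (N + i)))) =
      |cfVal (fun i => x (N + i)) - cfVal (fun i => y (N + i))| := by
  have h1 := cfVal_tail_mul hx N
  have h2 := cfVal_tail_mul hy N
  have hN := cf_congr h N (by omega)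
  have hN1 := cf_congr h (N + 1) le_rfl
  rw [← hN.1, ← hN.2, ← hN1.1, ← hN1.2] at h2
  have hdet : (cfNum x (N + 1) : ℝ) * cfDen x N - cfNum x N * cfDen x (N + 1) = (-1) ^ (N + 1) := by
    exact_mod_cast cf_det x N
  have p0 : (0 : ℝ) ≤ cfDen x N := by exact_mod_cast cfDen_nonneg hx N
  have p1 : (0 : ℝ) < cfDen x (N + 1) := by exact_mod_cast cfDen_succ_pos hx N
  have q0 : 0 ≤ cfVal (fun i => x (N + i)) := cfVal_nonneg fun _ => hx _
  have q1 : 0 ≤ cfVal (fun i => y (N + i)) := cfVal_nonneg fun _ => hy _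
  set v := cfVal (fun i => x (N + i))
  set v' := cfVal (fun i => y (N + i))
  have e : (cfVal x - cfVal y) * ((cfDen x (N + 1) + cfDen x N * v) *
      (cfDen x (N + 1) + cfDen x N * v')) = (-1) ^ (N + 1) * (v' - v) := by
    linear_combination (cfDen x (N + 1) + cfDen x N * v') * h1 -
      (cfDen x (N + 1) + cfDen x N * v) * h2 + (v' - v) * hdet
  have e' := congrArg abs e
  rw [abs_mul, abs_mul _ (v' - v), abs_pow, abs_neg, abs_one, one_pow, one_mul, abs_sub_comm v',
    abs_of_nonneg (a := (cfDen x (N + 1) + cfDen x N * v) * _) (by positivity)] at e'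
  exact e'

theorem cfDen_add_mul_bounds {x : ℕ → ℕ} (hx : ∀ n, 0 < x n) (N : ℕ) {v : ℝ} (h0 : 0 ≤ v)
    (h1 : v ≤ 1) : (cfDen x (N + 1) : ℝ) ≤ cfDen x (N + 1) + cfDen x N * v ∧
      cfDen x (N + 1) + cfDen x N * v ≤ 2 * (cfDen x (N + 1) : ℝ) := by
  have p0 : (0 : ℝ) ≤ cfDen x N := by exact_mod_cast cfDen_nonneg hx N
  have p1 : (cfDen x N : ℝ) ≤ cfDen x (N + 1) := by exact_mod_cast cfDen_le_succ hx N
  constructor <;> nlinarith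

theorem abs_cfVal_sub_le {x y : ℕ → ℕ} (hx : ∀ n, 0 < x n) (hy : ∀ n, 0 < y n) {N : ℕ}
    (h : ∀ i, 1 ≤ i → i ≤ N → x i = y i) :
    |cfVal x - cfVal y| * (cfDen x (N + 1) : ℝ) ^ 2 ≤ 1 := by
  have e := abs_cfVal_sub_mul hx hy h
  have q0 : 0 ≤ cfVal (fun i => x (N + i)) := cfVal_nonneg fun _ => hx _
  have q1 : 0 ≤ cfVal (fun i => y (N + i)) := cfVal_nonneg fun _ => hy _
  have r0 : cfVal (fun i => x (N + i)) ≤ 1 := cfVal_le_one fun _ => hx _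
  have r1 : cfVal (fun i => y (N + i)) ≤ 1 := cfVal_le_one fun _ => hy _
  have p1 : (0 : ℝ) < cfDen x (N + 1) := by exact_mod_cast cfDen_succ_pos hx N
  calc _ ≤ _ := by
        rw [sq]
        exact mul_le_mul_of_nonneg_left (mul_le_mul (cfDen_add_mul_bounds hx N q0 r0).1
          (cfDen_add_mul_bounds hx N q1 r1).1 p1.le
          (p1.le.trans (cfDen_add_mul_bounds hx N q0 r0).1)) (abs_nonneg _)
    _ = _ := e
    _ ≤ 1 := abs_sub_le_iff.mpr ⟨by linarith, by linarith⟩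

theorem le_abs_cfVal_sub {x y : ℕ → ℕ} (hx : ∀ n, 0 < x n) (hy : ∀ n, 0 < y n) {K : ℕ}
    (hxK : ∀ n, x n ≤ K) (hyK : ∀ n, y n ≤ K) {N : ℕ}
    (h : ∀ i, 1 ≤ i → i ≤ N → x i = y i) (hne : x (N + 1) ≠ y (N + 1)) :
    cfGap K ≤ |cfVal x - cfVal y| * (4 * (cfDen x (N + 1) : ℝ) ^ 2) := by
  have e := abs_cfVal_sub_mul hx hy h
  have q0 : 0 ≤ cfVal (fun i => x (N + i)) := cfVal_nonneg fun _ => hx _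
  have q1 : 0 ≤ cfVal (fun i => y (N + i)) := cfVal_nonneg fun _ => hy _
  have r0 : cfVal (fun i => x (N + i)) ≤ 1 := cfVal_le_one fun _ => hx _
  have r1 : cfVal (fun i => y (N + i)) ≤ 1 := cfVal_le_one fun _ => hy _
  have p0 : (0 : ℝ) ≤ cfDen x N := by exact_mod_cast cfDen_nonneg hx N
  have p1 : (0 : ℝ) < cfDen x (N + 1) := by exact_mod_cast cfDen_succ_pos hx N
  calc _ ≤ _ := cfGap_le_abs_cfVal_sub (x := fun i => x (N + i)) (y := fun i => y (N + i))
        (fun _ => hx _) (fun _ => hy _) (fun _ => hxK _) (fun _ => hyK _) hne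
    _ = _ := e.symm
    _ ≤ _ := by
        rw [show 4 * (cfDen x (N + 1) : ℝ) ^ 2 =
          (2 * (cfDen x (N + 1) : ℝ)) * (2 * (cfDen x (N + 1) : ℝ)) by ring]
        gcongr
        · exact (cfDen_add_mul_bounds hx N q0 r0).2
        · exact (cfDen_add_mul_bounds hx N q1 r1).2

theorem abs_cfNum_sub_mul {x : ℕ → ℕ} (hx : ∀ n, 0 < x n) (n : ℕ) :
    |cfNum x n - cfDen x n * cfVal x| *
      (cfDen x (n + 1) + cfDen x n * cfVal (fun i => x (n + i))) = 1 := by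
  have h1 := cfVal_tail_mul hx n
  have hdet : (cfNum x (n + 1) : ℝ) * cfDen x n - cfNum x n * cfDen x (n + 1) = (-1) ^ (n + 1) := by
    exact_mod_cast cf_det x n
  have p0 : (0 : ℝ) ≤ cfDen x n := by exact_mod_cast cfDen_nonneg hx n
  have p1 : (0 : ℝ) < cfDen x (n + 1) := by exact_mod_cast cfDen_succ_pos hx n
  have q0 : 0 ≤ cfVal (fun i => x (n + i)) := cfVal_nonneg fun _ => hx _
  set v := cfVal (fun i => x (n + i))
  have e : (cfNum x n - cfDen x n * cfVal x) * (cfDen x (n + 1) + cfDen x n * v) =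
      (-1) ^ n := by
    rw [pow_succ] at hdet
    linear_combination (-cfDen x n : ℝ) * h1 - hdet
  have e' := congrArg abs e
  rw [abs_mul, abs_pow, abs_neg, abs_one, one_pow, abs_of_nonneg (a := _ + _) (by positivity)] at e'
  exact e'

/-- Multiplying `|p - q ξ|` by the denominator of a rational `ξ` would give a nonzero integer, but
it is less than `1` once the next continuant exceeds that denominator. -/
theorem irrational_cfVal {x : ℕ → ℕ} (hx : ∀ n, 0 < x n) : Irrational (cfVal x) := by
  rintro ⟨q, hq⟩
  set n := q.den with hn
  have h := abs_cfNum_sub_mul hx (n + 1)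
  have q0 : 0 ≤ cfVal (fun i => x (n + 1 + i)) := cfVal_nonneg fun _ => hx _
  have q1 : cfVal (fun i => x (n + 1 + i)) ≤ 1 := cfVal_le_one fun _ => hx _
  have p1 : ((n : ℝ) + 1) ≤ cfDen x (n + 1 + 1) := by exact_mod_cast le_cfDen_succ hx (n + 1)
  have b := (cfDen_add_mul_bounds hx (n + 1) q0 q1).1
  have hd : (0 : ℝ) < q.den := by exact_mod_cast q.den_pos
  have e : (cfNum x (n + 1) - cfDen x (n + 1) * cfVal x) * q.den =
      ((cfNum x (n + 1) * q.den - cfDen x (n + 1) * q.num : ℤ) : ℝ) := by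
    have : (q : ℝ) * q.den = q.num := by exact_mod_cast Rat.mul_den_eq_num q
    rw [← hq]
    push_cast
    linear_combination -(cfDen x (n + 1) : ℝ) * this
  set z : ℤ := cfNum x (n + 1) * q.den - cfDen x (n + 1) * q.num
  set A := (cfNum x (n + 1) - cfDen x (n + 1) * cfVal x : ℝ)
  have hA : 0 < |A| := by
    by_contra hA
    have : |A| = 0 := le_antisymm (not_lt.mp hA) (abs_nonneg _)
    rw [this] at h
    simp at h
  have hz : z ≠ 0 := by
    intro hz
    rw [hz, Int.cast_zero] at e
    rcases mul_eq_zero.mp e with h' | h'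
    · simp [h'] at hA
    · exact hd.ne' h'
  have hz1 : (1 : ℝ) ≤ |(z : ℝ)| := by exact_mod_cast Int.one_le_abs hz
  rw [← e, abs_mul, abs_of_pos hd] at hz1
  have : |A| * ((q.den : ℝ) + 1) ≤ 1 :=
    (mul_le_mul_of_nonneg_left (p1.trans b) (abs_nonneg _)).trans h.le
  nlinarith

/-! ### The quadratic polynomial of a period and its content -/

/-- The quadratic polynomial vanishing at a continued fraction whose tails at `r` and `s` agree. -/
noncomputable def cfWedge (x : ℕ → ℕ) (r s : ℕ) : ℤ[X] :=
  (C (cfNum x (s + 1)) - C (cfDen x (s + 1)) * X) * (C (cfNum x r) - C (cfDen x r) * X) -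
    (C (cfNum x (r + 1)) - C (cfDen x (r + 1)) * X) * (C (cfNum x s) - C (cfDen x s) * X)

theorem cfWedge_eq (x : ℕ → ℕ) (r s : ℕ) : cfWedge x r s =
    C (cfDen x (s + 1) * cfDen x r - cfDen x (r + 1) * cfDen x s) * X ^ 2 +
    C (cfNum x (r + 1) * cfDen x s + cfDen x (r + 1) * cfNum x s - cfNum x (s + 1) * cfDen x r -
      cfDen x (s + 1) * cfNum x r) * X +
    C (cfNum x (s + 1) * cfNum x r - cfNum x (r + 1) * cfNum x s) := by
  unfold cfWedge
  simp only [map_sub, map_add, map_mul]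
  ring

/-- With `L_n = p_n - q_n ξ` the tail at `n` is `-L_(n+1) / L_n`; the polynomial is the difference
of the tails at `r` and `s` with denominators cleared. -/
theorem aeval_cfWedge {x : ℕ → ℕ} (hx : ∀ n, 0 < x n) (r s : ℕ) :
    aeval (cfVal x) (cfWedge x r s) =
      (cfVal (fun i => x (r + i)) - cfVal (fun i => x (s + i))) *
        (cfNum x r - cfDen x r * cfVal x) * (cfNum x s - cfDen x s * cfVal x) := by
  have h1 := cfVal_tail_mul hx r
  have h2 := cfVal_tail_mul hx s
  simp only [cfWedge, map_sub, map_mul, aeval_X, eq_intCast, map_intCast]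
  linear_combination -(cfNum x r - cfDen x r * cfVal x) * h2 +
    (cfNum x s - cfDen x s * cfVal x) * h1

/-- A common partial quotient cancels in this antisymmetric expression. Hence the starting point may
be moved along the periodic stretch at the cost of a sign only. -/
theorem cfWedge_succ {x : ℕ → ℕ} {r s : ℕ} (h : x (r + 1) = x (s + 1)) :
    cfWedge x (r + 1) (s + 1) = -cfWedge x r s := by
  unfold cfWedge
  rw [cfNum_add_two, cfNum_add_two, cfDen_add_two, cfDen_add_two, h]
  simp only [map_add, map_mul]
  ring

theorem cfWedge_add {x : ℕ → ℕ} {r s m : ℕ} (h : ∀ i, i < m → x (r + i + 1) = x (s + i + 1)) :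
    cfWedge x (r + m) (s + m) = (-1) ^ m * cfWedge x r s := by
  induction m with
  | zero => simp
  | succ m ih =>
    rw [← add_assoc, ← add_assoc, cfWedge_succ (h m (by omega)), ih fun i hi => h i (by omega)]
    ring

theorem cfDen_ratio_mul {x : ℕ → ℕ} (hx : ∀ n, 0 < x n) (n : ℕ) :
    (cfDen x (n + 1) : ℝ) / cfDen x (n + 2) * (x (n + 1) + cfDen x n / cfDen x (n + 1)) = 1 := by
  have h1 : (0 : ℝ) < cfDen x (n + 1) := by exact_mod_cast cfDen_succ_pos hx n
  have h2 : (0 : ℝ) < cfDen x (n + 2) := by exact_mod_cast cfDen_succ_pos hx (n + 1)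
  have e : (cfDen x (n + 2) : ℝ) = x (n + 1) * cfDen x (n + 1) + cfDen x n := by
    exact_mod_cast cfDen_add_two x n
  field_simp
  rw [e]
  ring

theorem cfDen_ratio_bounds {x : ℕ → ℕ} (hx : ∀ n, 0 < x n) {K : ℕ} (hK : ∀ n, x n ≤ K) (n : ℕ) :
    0 ≤ (cfDen x (n + 2) : ℝ) / cfDen x (n + 3) ∧
      (cfDen x (n + 2) : ℝ) / cfDen x (n + 3) ≤ 1 - 1 / ((K : ℝ) + 2) := by
  have hp : ∀ m, (0 : ℝ) < cfDen x (m + 1) := fun m => by exact_mod_cast cfDen_succ_pos hx m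
  have hn : (0 : ℝ) ≤ cfDen x n := by exact_mod_cast cfDen_nonneg hx n
  have h0 : ∀ m, 0 ≤ (cfDen x (m + 1) : ℝ) / cfDen x (m + 2) :=
    fun m => div_nonneg (hp m).le (hp (m + 1)).le
  refine ⟨h0 (n + 1), le_of_mul_add_eq_one (hx _) (h0 (n + 1)) ?_ (cfDen_ratio_mul hx (n + 1))⟩
  refine inv_succ_le_of_mul_add_eq_one (hK _) (h0 n) ?_ (cfDen_ratio_mul hx n)
  rw [div_le_one (hp n)]
  exact_mod_cast cfDen_le_succ hx n

/-- After division by `q_r q_s` this is a difference of two reversed continued fractions, whose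
integer parts are `x r` and `x s`. Indices from `3` on keep the fractional parts away from `1`. -/
theorem le_abs_cfDen_wedge {x : ℕ → ℕ} (hx : ∀ n, 0 < x n) {K : ℕ} (hK : ∀ n, x n ≤ K) {r s : ℕ}
    (hr : 3 ≤ r) (hs : 3 ≤ s) (h : x r ≠ x s) :
    1 / ((K : ℝ) + 2) * (cfDen x r * cfDen x s) ≤
      |((cfDen x (s + 1) * cfDen x r - cfDen x (r + 1) * cfDen x s : ℤ) : ℝ)| := by
  obtain ⟨r, rfl⟩ := Nat.exists_eq_add_of_le' hr
  obtain ⟨s, rfl⟩ := Nat.exists_eq_add_of_le' hs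
  have hp : ∀ m, (0 : ℝ) < cfDen x (m + 1) := fun m => by exact_mod_cast cfDen_succ_pos hx m
  have e : ∀ n, (cfDen x (n + 3 + 1) : ℝ) =
      (x (n + 3) + cfDen x (n + 2) / cfDen x (n + 3)) * cfDen x (n + 3) := fun n => by
    have e : (cfDen x (n + 4) : ℝ) = x (n + 3) * cfDen x (n + 3) + cfDen x (n + 2) := by
      exact_mod_cast cfDen_add_two x (n + 2)
    have := (hp (n + 2)).ne'
    rw [show n + 3 + 1 = n + 4 by ring, e]
    field_simp
  have b1 := cfDen_ratio_bounds hx hK r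
  have b2 := cfDen_ratio_bounds hx hK s
  have key := inv_le_abs_add_sub_add (K := K) h.symm b2.1 b1.1 b2.2 b1.2
  have hr0 : (0 : ℝ) < cfDen x (r + 3) := hp (r + 2)
  have hs0 : (0 : ℝ) < cfDen x (s + 3) := hp (s + 2)
  push_cast
  rw [e, e]
  generalize (cfDen x (r + 2) / cfDen x (r + 3) : ℝ) = u at *
  generalize (cfDen x (s + 2) / cfDen x (s + 3) : ℝ) = u' at *
  rw [show (x (s + 3) + u') * cfDen x (s + 3) * cfDen x (r + 3) -
    (x (r + 3) + u) * cfDen x (r + 3) * cfDen x (s + 3) =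
    ((x (s + 3) + u') - (x (r + 3) + u)) * ((cfDen x (r + 3) : ℝ) * cfDen x (s + 3)) by ring,
    abs_mul, abs_of_pos (mul_pos hr0 hs0)]
  gcongr

theorem coeff_cfWedge (x : ℕ → ℕ) (r s : ℕ) :
    (cfWedge x r s).coeff 0 = cfNum x (s + 1) * cfNum x r - cfNum x (r + 1) * cfNum x s ∧
    (cfWedge x r s).coeff 1 = cfNum x (r + 1) * cfDen x s + cfDen x (r + 1) * cfNum x s -
      cfNum x (s + 1) * cfDen x r - cfDen x (s + 1) * cfNum x r ∧
    (cfWedge x r s).coeff 2 = cfDen x (s + 1) * cfDen x r - cfDen x (r + 1) * cfDen x s := by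
  rw [cfWedge_eq]
  refine ⟨?_, ?_, ?_⟩ <;> simp only [coeff_add, coeff_C_mul, coeff_X_pow, coeff_X, coeff_C] <;>
    norm_num

theorem natDegree_cfWedge_le (x : ℕ → ℕ) (r s : ℕ) : (cfWedge x r s).natDegree ≤ 2 := by
  rw [cfWedge_eq]
  exact natDegree_quadratic_le

/-- The homogenized quadratic form, evaluated at the integer points `(p_r, q_r)` and `(p_(r+1),
q_(r+1))`, yields up to sign continuants of the period alone. The content divides both values. -/
theorem dvd_cfDen_and_cfNum_of_C_dvd_cfWedge {x : ℕ → ℕ} {k : ℤ} {r L : ℕ}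
    (h : C k ∣ cfWedge x r (r + L)) :
    k ∣ cfDen (fun i => x (r + i)) L ∧ k ∣ cfNum (fun i => x (r + i)) (L + 1) := by
  rw [C_dvd_iff_dvd_coeff] at h
  have h0 := h 0
  have h1 := h 1
  have h2 := h 2
  obtain ⟨e0, e1, e2⟩ := coeff_cfWedge x r (r + L)
  rw [e0] at h0
  rw [e1] at h1
  rw [e2] at h2
  have hdet := cf_det x r
  have n0 := cfNum_add x r L
  have d0 := cfDen_add x r L
  have n1 := cfNum_add x r (L + 1)
  have d1 := cfDen_add x r (L + 1)
  rw [← add_assoc] at n1 d1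
  have hsq : ((-1 : ℤ) ^ (r + 1)) ^ 2 = 1 := by rw [← pow_mul, mul_comm, pow_mul]; simp
  generalize cfNum x (r + L + 1) = ns1 at *
  generalize cfDen x (r + L + 1) = ds1 at *
  generalize cfNum x (r + L) = ns at *
  generalize cfDen x (r + L) = ds at *
  generalize cfNum x (r + 1) = nr1 at *
  generalize cfDen x (r + 1) = dr1 at *
  generalize cfNum x r = nr at *
  generalize cfDen x r = dr at *
  generalize (-1 : ℤ) ^ (r + 1) = e at *
  subst n0 d0 n1 d1
  constructor
  · have key := ((h2.mul_right (nr ^ 2)).add (h1.mul_right (nr * dr))).add (h0.mul_right (dr ^ 2))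
    refine (dvd_neg.mpr key).trans (dvd_of_eq ?_)
    linear_combination (cfDen (fun i => x (r + i)) L) * hsq +
      (cfDen (fun i => x (r + i)) L) * (nr1 * dr - nr * dr1 + e) * hdet
  · have key := ((h2.mul_right (nr1 ^ 2)).add (h1.mul_right (nr1 * dr1))).add
      (h0.mul_right (dr1 ^ 2))
    refine key.trans (dvd_of_eq ?_)
    linear_combination (cfNum (fun i => x (r + i)) (L + 1)) * hsq +
      (cfNum (fun i => x (r + i)) (L + 1)) * (nr1 * dr - nr * dr1 + e) * hdet

theorem cfNum_const_succ (a n : ℕ) : cfNum (fun _ => a) (n + 1) = cfDen (fun _ => a) n := by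
  induction n using Nat.twoStepInduction with
  | zero => simp [cfNum, cfDen]
  | one => simp [cfNum, cfDen]
  | more n h1 h2 => rw [cfNum_add_two, cfDen_add_two, h1, h2]

/-- The content of the quadratic form attached to the period `a, …, a, c` divides `c - a`. -/
theorem dvd_sub_of_dvd_cfDen_of_dvd_cfNum {z : ℕ → ℕ} {a c L : ℕ} {k : ℤ} (hL : 1 ≤ L)
    (hz : ∀ i, 1 ≤ i → i < L → z i = a) (hzL : z L = c) (h1 : k ∣ cfDen z L)
    (h2 : k ∣ cfNum z (L + 1)) : k ∣ (c : ℤ) - a := by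
  obtain ⟨L, rfl⟩ := Nat.exists_eq_add_of_le' hL
  have hc := cf_congr (x := z) (y := fun _ => a) (N := L) fun i hi hi' => hz i hi (by omega)
  have e := cfNum_const_succ a (L + 1)
  rw [← (hc (L + 1) le_rfl).2, cfNum_add_two, ← (hc (L + 1) le_rfl).1,
    ← (hc L (by omega)).1] at e
  rw [cfNum_add_two, hzL] at h2
  -- Were the last letter `a` instead of `c`, the two given continuants would coincide, by `e`.
  -- Their difference is thus `c - a` times a continuant, which is coprime to `cfDen z (L + 1)` by
  -- the determinant identity.
  have h3 : k ∣ ((c : ℤ) - a) * cfNum z (L + 1) := by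
    refine (dvd_sub h2 h1).trans (dvd_of_eq ?_)
    rw [← e]
    ring
  have hdet := cf_det z L
  refine IsCoprime.dvd_of_dvd_mul_right ?_ h3
  refine IsCoprime.of_isCoprime_of_dvd_left ?_ h1
  refine ⟨-(-1) ^ (L + 1) * cfNum z L, (-1) ^ (L + 1) * cfDen z L, ?_⟩
  have hsq : ((-1 : ℤ) ^ (L + 1)) ^ 2 = 1 := by rw [← pow_mul, mul_comm, pow_mul]; simp
  linear_combination (-1 : ℤ) ^ (L + 1) * hdet + hsq

theorem cfVal_congr {x y : ℕ → ℕ} (h : ∀ i, 1 ≤ i → x i = y i) : cfVal x = cfVal y := by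
  unfold cfVal
  congr 1
  funext n
  have := cf_congr (N := n) (fun i hi _ => h i hi) n (by omega)
  rw [this.1, this.2]

theorem cfDen_add_bounds {x : ℕ → ℕ} (hx : ∀ n, 0 < x n) (N : ℕ) {m : ℕ} (hm : 1 ≤ m) :
    cfDen x (N + 1) * cfDen (fun i => x (N + i)) m ≤ cfDen x (N + m) ∧
      cfDen x (N + m) ≤ 2 * (cfDen x (N + 1) * cfDen (fun i => x (N + i)) m) := by
  obtain ⟨m, rfl⟩ := Nat.exists_eq_add_of_le' hm
  rw [cfDen_add x N (m + 1)]
  have h0 := cfNum_nonneg (fun i => x (N + i)) (m + 1)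
  have h1 := cfNum_le_cfDen (x := fun i => x (N + i)) (fun _ => hx _) m
  have h2 := cfDen_nonneg hx N
  have h3 := cfDen_le_succ hx N
  have h4 : cfDen x N * cfNum (fun i => x (N + i)) (m + 1) ≤
      cfDen x (N + 1) * cfDen (fun i => x (N + i)) (m + 1) := by gcongr; exact h2.trans h3
  constructor <;> nlinarith [mul_nonneg h2 h0]

theorem abs_cfNum_sub_bounds {x : ℕ → ℕ} (hx : ∀ n, 0 < x n) (n : ℕ) :
    1 / (2 * (cfDen x (n + 1) : ℝ)) ≤ |cfNum x n - cfDen x n * cfVal x| ∧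
      |cfNum x n - cfDen x n * cfVal x| ≤ 1 / (cfDen x (n + 1) : ℝ) := by
  have e := abs_cfNum_sub_mul hx n
  have b := cfDen_add_mul_bounds hx n (cfVal_nonneg (x := fun i => x (n + i)) fun _ => hx _)
    (cfVal_le_one fun _ => hx _)
  have p1 : (0 : ℝ) < cfDen x (n + 1) := by exact_mod_cast cfDen_succ_pos hx n
  rw [div_le_iff₀ (by positivity), le_div_iff₀ p1]
  have := abs_nonneg (cfNum x n - cfDen x n * cfVal x)
  constructor <;> nlinarith

/-- In `aeval_cfWedge` the tails at `r` and `s` first differ after `R - s - 1` common terms, so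
their distance is of order `(q_s / q_R)^2`; the two linear factors contribute the order of `1 / (q_r
q_s)`. -/
theorem aeval_cfWedge_bounds {x : ℕ → ℕ} (hx : ∀ n, 0 < x n) {K : ℕ} (hK : ∀ n, x n ≤ K)
    {r s R : ℕ} (hrs : r ≤ s) (hsR : s < R)
    (hper : ∀ i, r < i → i + (s - r) < R → x i = x (i + (s - r))) (hne : x (R - (s - r)) ≠ x R) :
    cfGap K / 16 * (cfDen x (s + 1) / (cfDen x (r + 1) * cfDen x R ^ 2)) ≤
        |aeval (cfVal x) (cfWedge x r s)| ∧
      |aeval (cfVal x) (cfWedge x r s)| ≤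
        4 * (cfDen x (s + 1) / (cfDen x (r + 1) * cfDen x R ^ 2)) := by
  have hagree : ∀ i, 1 ≤ i → i ≤ R - s - 1 → x (s + i) = x (r + i) := fun i hi hi' => by
    rw [hper (r + i) (by omega) (by omega)]
    congr 1
    omega
  have hne' : x (s + (R - s - 1 + 1)) ≠ x (r + (R - s - 1 + 1)) := by
    rw [show s + (R - s - 1 + 1) = R by omega, show r + (R - s - 1 + 1) = R - (s - r) by omega]
    exact hne.symm
  have u := abs_cfVal_sub_le (x := fun i => x (s + i)) (y := fun i => x (r + i)) (fun _ => hx _)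
    (fun _ => hx _) hagree
  have l := le_abs_cfVal_sub (x := fun i => x (s + i)) (y := fun i => x (r + i)) (fun _ => hx _)
    (fun _ => hx _) (fun _ => hK _) (fun _ => hK _) hagree hne'
  rw [show R - s - 1 + 1 = R - s by omega] at u l
  obtain ⟨t1, t2⟩ := cfDen_add_bounds hx s (m := R - s) (by omega)
  rw [show s + (R - s) = R by omega] at t1 t2
  obtain ⟨a1, a2⟩ := abs_cfNum_sub_bounds hx r
  obtain ⟨b1, b2⟩ := abs_cfNum_sub_bounds hx s
  have pr : (0 : ℝ) < cfDen x (r + 1) := by exact_mod_cast cfDen_succ_pos hx r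
  have ps : (0 : ℝ) < cfDen x (s + 1) := by exact_mod_cast cfDen_succ_pos hx s
  have pR : (0 : ℝ) < cfDen x R := by
    have := cfDen_succ_pos hx (R - 1)
    rw [show R - 1 + 1 = R by omega] at this
    exact_mod_cast this
  have pd : (0 : ℝ) < cfDen (fun i => x (s + i)) (R - s) := by
    have := cfDen_succ_pos (x := fun i => x (s + i)) (fun _ => hx _) (R - s - 1)
    rw [show R - s - 1 + 1 = R - s by omega] at this
    exact_mod_cast this
  have t1' : (cfDen x (s + 1) : ℝ) * cfDen (fun i => x (s + i)) (R - s) ≤ cfDen x R := by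
    exact_mod_cast t1
  have t2' : (cfDen x R : ℝ) ≤ 2 * (cfDen x (s + 1) * cfDen (fun i => x (s + i)) (R - s)) := by
    exact_mod_cast t2
  rw [aeval_cfWedge hx, abs_mul, abs_mul, abs_sub_comm]
  set v := |cfVal (fun i => x (s + i)) - cfVal (fun i => x (r + i))|
  set Ar := |cfNum x r - cfDen x r * cfVal x|
  set As := |cfNum x s - cfDen x s * cfVal x|
  set d : ℝ := (cfDen (fun i => x (s + i)) (R - s) : ℝ)
  set Dr : ℝ := (cfDen x (r + 1) : ℝ)
  set Ds : ℝ := (cfDen x (s + 1) : ℝ)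
  set DR : ℝ := (cfDen x R : ℝ)
  have hv0 : 0 ≤ v := abs_nonneg _
  have hg := cfGap_pos K
  have v1 : cfGap K / 4 * (Ds ^ 2 / DR ^ 2) ≤ v := by
    rw [div_mul_div_comm, div_le_iff₀ (by positivity)]
    calc cfGap K * Ds ^ 2 ≤ v * (4 * d ^ 2) * Ds ^ 2 := by gcongr
      _ = v * (4 * (Ds * d) ^ 2) := by ring
      _ ≤ v * (4 * DR ^ 2) := by gcongr
      _ = _ := by ring
  have v2 : v ≤ 4 * (Ds ^ 2 / DR ^ 2) := by
    rw [mul_div_assoc', le_div_iff₀ (by positivity)]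
    calc v * DR ^ 2 ≤ v * (2 * (Ds * d)) ^ 2 := by gcongr
      _ = 4 * Ds ^ 2 * (v * d ^ 2) := by ring
      _ ≤ 4 * Ds ^ 2 * 1 := by gcongr
      _ = _ := by ring
  constructor
  · calc _ = cfGap K / 4 * (Ds ^ 2 / DR ^ 2) * (1 / (2 * Dr)) * (1 / (2 * Ds)) := by
          field_simp; norm_num
      _ ≤ _ := by gcongr
  · calc _ ≤ 4 * (Ds ^ 2 / DR ^ 2) * (1 / Dr) * (1 / Ds) := by gcongr
      _ = _ := by field_simp

/-! ### The quadratic irrational obtained by continuing the period -/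

/-- The eventually periodic sequence agreeing with `x` up to index `s` and having the period
`x (r + 1), …, x s`. -/
def periodize (x : ℕ → ℕ) (r s : ℕ) (i : ℕ) : ℕ :=
  if i ≤ r then x i else x (r + 1 + (i - r - 1) % (s - r))

theorem periodize_add {x : ℕ → ℕ} {r s i : ℕ} (hi : r < i) :
    periodize x r s (i + (s - r)) = periodize x r s i := by
  unfold periodize
  rw [if_neg (by omega), if_neg (by omega),
    show i + (s - r) - r - 1 = i - r - 1 + (s - r) by omega, Nat.add_mod_right]

theorem periodize_eq {x : ℕ → ℕ} {r s R : ℕ} (hrs : r < s)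
    (hper : ∀ i, r < i → i + (s - r) < R → x i = x (i + (s - r))) {i : ℕ}
    (hi : i < R) : periodize x r s i = x i := by
  induction i using Nat.strong_induction_on with
  | _ i ih =>
    rcases le_or_gt i s with his | his
    · unfold periodize
      split_ifs with h
      · rfl
      · rw [Nat.mod_eq_of_lt (by omega)]
        congr 1
        omega
    · obtain ⟨j, rfl⟩ : ∃ j, i = j + (s - r) := ⟨i - (s - r), by omega⟩
      rw [periodize_add (by omega), ih j (by omega) (by omega), hper j (by omega) hi]

/-- The polynomial sees only the first `s` partial quotients, so it is unchanged by periodization,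
after which the tails at `r` and `s` are equal. -/
theorem aeval_periodize {x : ℕ → ℕ} (hx : ∀ n, 0 < x n) {r s : ℕ} (hrs : r < s) :
    aeval (cfVal (periodize x r s)) (cfWedge x r s) = 0 := by
  have hy : ∀ n, 0 < periodize x r s n := fun n => by unfold periodize; split_ifs <;> exact hx _
  have hag : ∀ i, i < s + 1 → periodize x r s i = x i := fun i hi =>
    periodize_eq hrs (fun i _ _ => by omega) hi
  have hc := cf_congr (x := periodize x r s) (y := x) (N := s) fun i _ hi => hag i (by omega)
  have e : cfWedge (periodize x r s) r s = cfWedge x r s := by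
    unfold cfWedge
    rw [(hc r (by omega)).1, (hc r (by omega)).2, (hc s (by omega)).1, (hc s (by omega)).2,
      (hc (r + 1) (by omega)).1, (hc (r + 1) (by omega)).2, (hc (s + 1) (by omega)).1,
      (hc (s + 1) (by omega)).2]
  rw [← e, aeval_cfWedge hy, sub_eq_zero.mpr, zero_mul, zero_mul]
  refine cfVal_congr fun i hi => ?_
  rw [← periodize_add (by omega)]
  congr 1
  omega

theorem abs_cfVal_sub_periodize_bounds {x : ℕ → ℕ} (hx : ∀ n, 0 < x n) {K : ℕ}
    (hK : ∀ n, x n ≤ K) {r s R : ℕ} (hrs : r < s) (hsR : s < R)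
    (hper : ∀ i, r < i → i + (s - r) < R → x i = x (i + (s - r)))
    (hne : x (R - (s - r)) ≠ x R) :
    cfGap K / 4 * (1 / (cfDen x R : ℝ) ^ 2) ≤ |cfVal x - cfVal (periodize x r s)| ∧
      |cfVal x - cfVal (periodize x r s)| ≤ 1 / (cfDen x R : ℝ) ^ 2 := by
  have hy : ∀ n, 0 < periodize x r s n := fun n => by unfold periodize; split_ifs <;> exact hx _
  have hyK : ∀ n, periodize x r s n ≤ K := fun n => by
    unfold periodize; split_ifs <;> exact hK _
  obtain ⟨N, rfl⟩ : ∃ N, R = N + 1 := ⟨R - 1, by omega⟩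
  have hag : ∀ i, 1 ≤ i → i ≤ N → x i = periodize x r s i := fun i _ hi =>
    (periodize_eq hrs hper (by omega)).symm
  have hne' : x (N + 1) ≠ periodize x r s (N + 1) := by
    have := periodize_add (x := x) (s := s) (show r < N + 1 - (s - r) by omega)
    rw [show N + 1 - (s - r) + (s - r) = N + 1 by omega,
      periodize_eq (i := N + 1 - (s - r)) hrs hper (by omega)] at this
    rw [this]
    exact hne.symm
  have u := abs_cfVal_sub_le hx hy hag
  have l := le_abs_cfVal_sub hx hy hK hyK hag hne'
  have p1 : (0 : ℝ) < cfDen x (N + 1) := by exact_mod_cast cfDen_succ_pos hx N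
  constructor
  · rw [div_mul_div_comm, div_le_iff₀ (by positivity)]
    linarith
  · rw [le_div_iff₀ (by positivity)]
    exact u

theorem abs_coeff_cfWedge_le {x : ℕ → ℕ} (hx : ∀ n, 0 < x n) {r s : ℕ} (hr : 1 ≤ r) (hs : 1 ≤ s)
    (i : ℕ) : |(cfWedge x r s).coeff i| ≤ 2 * (cfDen x (r + 1) * cfDen x (s + 1)) := by
  obtain ⟨r, rfl⟩ := Nat.exists_eq_add_of_le' hr
  obtain ⟨s, rfl⟩ := Nat.exists_eq_add_of_le' hs
  have d0 := cfDen_nonneg hx (r + 1)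
  have d0' := cfDen_nonneg hx (s + 1)
  have n0 := cfNum_nonneg x (r + 1)
  have n0' := cfNum_nonneg x (s + 1)
  have m0 := cfNum_nonneg x (r + 2)
  have m0' := cfNum_nonneg x (s + 2)
  have nd := cfNum_le_cfDen hx r
  have nd' := cfNum_le_cfDen hx s
  have md := cfNum_le_cfDen hx (r + 1)
  have md' := cfNum_le_cfDen hx (s + 1)
  have dd := cfDen_le_succ hx (r + 1)
  have dd' := cfDen_le_succ hx (s + 1)
  obtain ⟨e0, e1, e2⟩ := coeff_cfWedge x (r + 1) (s + 1)
  have key : ∀ p q : ℤ, 0 ≤ p → 0 ≤ q → p ≤ cfDen x (r + 2) → q ≤ cfDen x (s + 2) →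
      0 ≤ p * q ∧ p * q ≤ cfDen x (r + 2) * cfDen x (s + 2) := fun p q hp hq hp' hq' =>
    ⟨mul_nonneg hp hq, mul_le_mul hp' hq' hq (hp.trans hp')⟩
  match i with
  | 0 =>
    rw [e0, abs_le]
    have k1 := key _ _ n0 m0' (nd.trans dd) md'
    have k2 := key _ _ m0 n0' md (nd'.trans dd')
    constructor <;> linarith
  | 1 =>
    rw [e1, abs_le]
    have k1 := key _ _ m0 d0' md dd'
    have k2 := key _ _ (d0.trans dd) n0' le_rfl (nd'.trans dd')
    have k3 := key _ _ d0 m0' dd md'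
    have k4 := key _ _ n0 (d0'.trans dd') (nd.trans dd) le_rfl
    constructor <;> linarith
  | 2 =>
    rw [e2, abs_le]
    have k1 := key _ _ d0 (d0'.trans dd') dd le_rfl
    have k2 := key _ _ (d0.trans dd) d0' le_rfl dd'
    constructor <;> linarith
  | i + 3 =>
    rw [coeff_eq_zero_of_natDegree_lt (by have := natDegree_cfWedge_le x (r + 1) (s + 1); omega)]
    have k1 := key _ _ (d0.trans dd) (d0'.trans dd') le_rfl le_rfl
    simpa using k1.1

/-! ### Growth of the denominators -/

/-- The number of indices `1 ≤ i ≤ n` with `x i ≠ a`. -/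
def exceptionCount (x : ℕ → ℕ) (a n : ℕ) : ℕ := {i ∈ Finset.Icc 1 n | x i ≠ a}.card

theorem exceptionCount_succ (x : ℕ → ℕ) (a n : ℕ) : exceptionCount x a (n + 1) =
    exceptionCount x a n + if x (n + 1) = a then 0 else 1 := by
  unfold exceptionCount
  rw [← Finset.insert_Icc_right_eq_Icc_add_one (by omega), Finset.filter_insert]
  by_cases h : x (n + 1) = a <;> simp [h]

/-- The combination `θ q_(n+1) + q_n` is an eigenvector functional: a partial quotient `a`
multiplies it by exactly `θ`, and any other one changes this by a factor between `1 / K` and `K`.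
Finally it lies between `θ q_(n+1)` and `2 θ q_(n+1)`. -/
theorem abs_log_cfDen_sub_le {x : ℕ → ℕ} (hx : ∀ n, 0 < x n) {K : ℕ} (hK : ∀ n, x n ≤ K) {a : ℕ}
    (ha : 0 < a) (haK : a ≤ K) {θ : ℝ} (hθ : 1 < θ) (hθa : θ ^ 2 = a * θ + 1) (n : ℕ) :
    |Real.log (cfDen x (n + 1)) - n * Real.log θ| ≤
      exceptionCount x a n * Real.log K + Real.log 2 := by
  have ha1 : (1 : ℝ) ≤ a := by exact_mod_cast ha
  have hK1 : (1 : ℝ) ≤ K := by exact_mod_cast ha.trans_le haK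
  have hθ0 : 0 < θ := by linarith
  have hp : ∀ m, (0 : ℝ) < cfDen x (m + 1) := fun m => by exact_mod_cast cfDen_succ_pos hx m
  have h0 : ∀ m, (0 : ℝ) ≤ cfDen x m := fun m => by exact_mod_cast cfDen_nonneg hx m
  have hF : ∀ m, (0 : ℝ) < θ * cfDen x (m + 1) + cfDen x m := fun m =>
    add_pos_of_pos_of_nonneg (mul_pos hθ0 (hp m)) (h0 m)
  have step : ∀ m, |Real.log (θ * cfDen x (m + 2) + cfDen x (m + 1)) -
      Real.log (θ * cfDen x (m + 1) + cfDen x m) - Real.log θ| ≤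
      (if x (m + 1) = a then 0 else 1) * Real.log K := by
    intro m
    have e : (cfDen x (m + 2) : ℝ) = x (m + 1) * cfDen x (m + 1) + cfDen x m := by
      exact_mod_cast cfDen_add_two x m
    rw [sub_sub, ← Real.log_mul (hF m).ne' hθ0.ne']
    split_ifs with h
    · rw [e, h, show θ * (a * (cfDen x (m + 1) : ℝ) + cfDen x m) + cfDen x (m + 1) =
        (θ * cfDen x (m + 1) + cfDen x m) * θ by
          linear_combination (-cfDen x (m + 1) : ℝ) * hθa]
      simp
    · have hx1 : (1 : ℝ) ≤ x (m + 1) := by exact_mod_cast hx _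
      have hxK : (x (m + 1) : ℝ) ≤ K := by exact_mod_cast hK _
      have haK' : (a : ℝ) ≤ K := by exact_mod_cast haK
      have hFm := hF m
      have hFm1 := hF (m + 1)
      rw [one_mul, abs_le]
      constructor
      · rw [neg_le_sub_iff_le_add, ← Real.log_mul (hF (m + 1)).ne' (by positivity)]
        apply Real.log_le_log (by positivity)
        rw [e]
        have t1 : (a : ℝ) * (θ * cfDen x (m + 1)) ≤
            x (m + 1) * K * (θ * cfDen x (m + 1)) := by
          have := mul_pos hθ0 (hp m)
          gcongr
          nlinarith
        have t2 := mul_nonneg hθ0.le (h0 m)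
        nlinarith [hp m]
      · rw [sub_le_iff_le_add, ← Real.log_mul (by positivity) (by positivity)]
        apply Real.log_le_log (hF (m + 1))
        rw [e]
        have t1 : (x (m + 1) : ℝ) * (θ * cfDen x (m + 1)) ≤
            K * a * (θ * cfDen x (m + 1)) := by
          have := mul_pos hθ0 (hp m)
          gcongr
          nlinarith
        have t2 := mul_nonneg (sub_nonneg.mpr hK1) (mul_nonneg hθ0.le (h0 m))
        have t3 := mul_nonneg (sub_nonneg.mpr hK1) (hp m).le
        have t4 : K * ((θ * cfDen x (m + 1) + cfDen x m) * θ) = K * a * (θ * cfDen x (m + 1)) +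
            K * cfDen x (m + 1) + K * (θ * cfDen x m) := by
          linear_combination (K * cfDen x (m + 1) : ℝ) * hθa
        linarith
  have main : ∀ m, |Real.log (θ * cfDen x (m + 1) + cfDen x m) - (m + 1) * Real.log θ| ≤
      exceptionCount x a m * Real.log K := by
    intro m
    induction m with
    | zero => simp [cfDen, exceptionCount]
    | succ m ih =>
      rw [exceptionCount_succ]
      have := step m
      push_cast at this ⊢
      rw [abs_le] at *
      constructor <;> linarith [this.1, this.2, ih.1, ih.2]
  have hm := main n
  have u : Real.log (cfDen x (n + 1)) + Real.log θ ≤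
      Real.log (θ * cfDen x (n + 1) + cfDen x n) := by
    rw [← Real.log_mul (hp n).ne' hθ0.ne']
    apply Real.log_le_log (mul_pos (hp n) hθ0)
    linarith [h0 n]
  have l : Real.log (θ * cfDen x (n + 1) + cfDen x n) ≤
      Real.log (cfDen x (n + 1)) + Real.log θ + Real.log 2 := by
    rw [← Real.log_mul (hp n).ne' hθ0.ne', ← Real.log_mul (mul_pos (hp n) hθ0).ne' two_ne_zero]
    apply Real.log_le_log (hF n)
    have : (cfDen x n : ℝ) ≤ cfDen x (n + 1) := by exact_mod_cast cfDen_le_succ hx n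
    nlinarith [hp n]
  rw [abs_le] at *
  have := Real.log_nonneg one_le_two
  constructor <;> linarith [hm.1, hm.2]

/-! ### Combinatorics of the partial quotients -/

theorem natCast_floor_pow {w : ℝ} (hw : 4 ≤ w) (i : ℕ) : ((⌊w ^ i⌋₊ : ℕ) : ℤ) = ⌊w ^ i⌋ :=
  Int.natCast_floor_eq_floor (by positivity)

theorem floor_pow_add_lt {w : ℝ} (hw : 4 ≤ w) (i : ℕ) : ⌊w ^ i⌋₊ + 2 ≤ ⌊w ^ (i + 1)⌋₊ := by
  have h1 : 1 ≤ w ^ i := one_le_pow₀ (by linarith)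
  have h2 := Nat.floor_le (show 0 ≤ w ^ i by positivity)
  rw [Nat.le_floor_iff (by positivity), pow_succ]
  push_cast
  nlinarith

theorem strictMono_floor_pow {w : ℝ} (hw : 4 ≤ w) : StrictMono (fun i : ℕ => ⌊w ^ i⌋₊) :=
  strictMono_nat_of_lt_succ fun i => by have := floor_pow_add_lt hw i; omega

/-- The positions of the partial quotients `c` of `partQuot`, up to those where the partial quotient
is `b`. -/
def IsMarked (w η : ℝ) (n : ℕ) : Prop :=
  ∃ j : ℕ, 1 ≤ j ∧ 0 < ⌊η * w ^ j⌋₊ ∧ ∃ m : ℕ, 1 ≤ m ∧ n = ⌊w ^ j⌋₊ + m * ⌊η * w ^ j⌋₊ ∧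
    n ≤ ⌊w ^ (j + 1)⌋₊ + 1

theorem isMarked_iff {w η : ℝ} (hw : 4 ≤ w) (hη : 0 < η) (n : ℕ) :
    (∃ j : ℕ, 1 ≤ j ∧ ∃ m : ℤ, 1 ≤ m ∧ m ≤ mBound w η j ∧
      (n : ℤ) = ⌊w ^ j⌋ + m * ⌊η * w ^ j⌋) ↔ IsMarked w η n := by
  have hℓ : ∀ j : ℕ, ((⌊η * w ^ j⌋₊ : ℕ) : ℤ) = ⌊η * w ^ j⌋ := fun j =>
    Int.natCast_floor_eq_floor (by positivity)
  -- The `+ 1` on the right comes from `⌊w ^ i - 1⌋` in `mBound`: a mark may overshoot the end of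
  -- its block by one place.
  have hbound : ∀ (j m : ℕ), 0 < ⌊η * w ^ j⌋₊ → ((m : ℤ) ≤ mBound w η j ↔
      ⌊w ^ j⌋₊ + m * ⌊η * w ^ j⌋₊ ≤ ⌊w ^ (j + 1)⌋₊ + 1) := by
    intro j m hpos
    have hpos' : (0 : ℝ) < ((⌊η * w ^ j⌋₊ : ℕ) : ℝ) := by exact_mod_cast hpos
    unfold mBound
    rw [Int.floor_sub_one, ← natCast_floor_pow hw, ← natCast_floor_pow hw, ← hℓ, Int.le_floor,
      Int.cast_natCast, Int.cast_natCast, Int.cast_natCast, le_div_iff₀ hpos']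
    push_cast
    rw [← Nat.cast_le (α := ℝ)]
    push_cast
    constructor <;> intro h <;> linarith
  constructor
  · rintro ⟨j, hj, m, hm, hmb, hn⟩
    lift m to ℕ using by omega
    rcases Nat.eq_zero_or_pos ⌊η * w ^ j⌋₊ with h0 | hpos
    · exfalso
      unfold mBound at hmb
      rw [← hℓ, h0] at hmb
      simp at hmb
      omega
    · rw [← natCast_floor_pow hw, ← hℓ] at hn
      have hn' : n = ⌊w ^ j⌋₊ + m * ⌊η * w ^ j⌋₊ := by exact_mod_cast hn
      exact ⟨j, hj, hpos, m, by exact_mod_cast hm, hn', hn' ▸ (hbound j m hpos).mp hmb⟩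
  · rintro ⟨j, hj, hpos, m, hm, hn, hle⟩
    refine ⟨j, hj, m, by exact_mod_cast hm, (hbound j m hpos).mpr (hn ▸ hle), ?_⟩
    rw [← natCast_floor_pow hw, ← hℓ]
    exact_mod_cast hn

open Classical in
theorem partQuot_eq {w η : ℝ} (hw : 4 ≤ w) (hη : 0 < η) (a b c n : ℕ) :
    partQuot w η a b c n =
      if ∃ i : ℕ, n = ⌊w ^ i⌋₊ then b else if IsMarked w η n then c else a := by
  unfold partQuot
  have e : (∃ i : ℕ, (n : ℤ) = ⌊w ^ i⌋) ↔ ∃ i : ℕ, n = ⌊w ^ i⌋₊ := by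
    simp only [← natCast_floor_pow hw, Nat.cast_inj]
  simp only [e, isMarked_iff hw hη]

theorem partQuot_mem (w η : ℝ) (a b c n : ℕ) :
    partQuot w η a b c n = a ∨ partQuot w η a b c n = b ∨ partQuot w η a b c n = c := by
  unfold partQuot
  split_ifs <;> simp

theorem partQuot_pos {w η : ℝ} {a b c : ℕ} (ha : 0 < a) (hb : 0 < b) (hc : 0 < c) (n : ℕ) :
    0 < partQuot w η a b c n := by
  rcases partQuot_mem w η a b c n with h | h | h <;> rw [h] <;> assumption

theorem partQuot_le (w η : ℝ) (a b c n : ℕ) : partQuot w η a b c n ≤ a + b + c := by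
  rcases partQuot_mem w η a b c n with h | h | h <;> rw [h] <;> omega

theorem partQuot_floor {w η : ℝ} (hw : 4 ≤ w) (hη : 0 < η) (a b c j : ℕ) :
    partQuot w η a b c ⌊w ^ j⌋₊ = b := by
  rw [partQuot_eq hw hη, if_pos ⟨j, rfl⟩]

theorem ne_floor_pow {w : ℝ} (hw : 4 ≤ w) {j n : ℕ} (h1 : ⌊w ^ j⌋₊ < n)
    (h2 : n < ⌊w ^ (j + 1)⌋₊) : ¬∃ i : ℕ, n = ⌊w ^ i⌋₊ := by
  rintro ⟨i, rfl⟩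
  have := (strictMono_floor_pow hw).lt_iff_lt.mp h1
  have := (strictMono_floor_pow hw).lt_iff_lt.mp h2
  omega

theorem partQuot_between {w η : ℝ} (hw : 4 ≤ w) (hη : 0 < η) (a b c : ℕ) {j n : ℕ}
    (h1 : ⌊w ^ j⌋₊ < n) (h2 : n < ⌊w ^ (j + 1)⌋₊) :
    partQuot w η a b c n = a ∨ partQuot w η a b c n = c := by
  rw [partQuot_eq hw hη, if_neg (ne_floor_pow hw h1 h2)]
  split_ifs <;> simp

open Classical in
theorem partQuot_block {w η : ℝ} (hw : 4 ≤ w) (hη : 0 < η) (a b c : ℕ) {j n : ℕ} (hj : 1 ≤ j)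
    (hℓ : 0 < ⌊η * w ^ j⌋₊) (h1 : ⌊w ^ j⌋₊ + 1 < n) (h2 : n < ⌊w ^ (j + 1)⌋₊) :
    partQuot w η a b c n = if ⌊η * w ^ j⌋₊ ∣ n - ⌊w ^ j⌋₊ then c else a := by
  rw [partQuot_eq hw hη, if_neg (ne_floor_pow hw (by omega) h2)]
  congr 1
  apply propext
  constructor
  · rintro ⟨i, hi, hpos, m, hm, hn, hle⟩
    have hmono := (strictMono_floor_pow hw).monotone
    rcases lt_trichotomy i j with h | rfl | h
    · have := hmono (show i + 1 ≤ j by omega)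
      simp only at this
      omega
    · rw [hn, Nat.add_sub_cancel_left]
      exact dvd_mul_left _ _
    · have := hmono (show j + 1 ≤ i by omega)
      simp only at this
      omega
  · rintro ⟨m, hm⟩
    refine ⟨j, hj, hℓ, m, ?_, ?_, by omega⟩
    · rcases Nat.eq_zero_or_pos m with rfl | h
      · omega
      · exact h
    · rw [mul_comm m]
      omega

theorem partQuot_structure {w η : ℝ} (hw : 4 ≤ w) (hη : 0 < η) {a b c : ℕ} (hac : a ≠ c)
    (hab : a ≠ b) (hbc : b ≠ c) {j : ℕ} (hj : 1 ≤ j) (hℓ : 2 ≤ ⌊η * w ^ j⌋₊)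
    (hlong : ⌊w ^ j⌋₊ + 2 * ⌊η * w ^ j⌋₊ + 2 < ⌊w ^ (j + 1)⌋₊) :
    ∃ r, (r = ⌊w ^ j⌋₊ ∨ r = ⌊w ^ j⌋₊ + 1) ∧
      partQuot w η a b c r ≠ partQuot w η a b c (r + ⌊η * w ^ j⌋₊) ∧
      (∀ i, r < i → i + ⌊η * w ^ j⌋₊ < ⌊w ^ (j + 1)⌋₊ →
        partQuot w η a b c i = partQuot w η a b c (i + ⌊η * w ^ j⌋₊)) ∧
      partQuot w η a b c (⌊w ^ (j + 1)⌋₊ - ⌊η * w ^ j⌋₊) ≠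
        partQuot w η a b c ⌊w ^ (j + 1)⌋₊ ∧
      (∀ i, 1 ≤ i → i < ⌊η * w ^ j⌋₊ →
        partQuot w η a b c (⌊w ^ j⌋₊ + ⌊η * w ^ j⌋₊ + i) = a) ∧
      partQuot w η a b c (⌊w ^ j⌋₊ + ⌊η * w ^ j⌋₊ + ⌊η * w ^ j⌋₊) = c := by
  classical
  have hblock : ∀ n, ⌊w ^ j⌋₊ + 1 < n → n < ⌊w ^ (j + 1)⌋₊ → _ := fun n h1 h2 =>
    partQuot_block hw hη a b c hj (by omega) h1 h2
  have hR := partQuot_floor hw hη a b c j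
  have hR' := partQuot_floor hw hη a b c (j + 1)
  have hbetween : ∀ n, ⌊w ^ j⌋₊ < n → n < ⌊w ^ (j + 1)⌋₊ → _ := fun n h1 h2 =>
    partQuot_between hw hη a b c h1 h2
  generalize partQuot w η a b c = x at *
  generalize ⌊w ^ j⌋₊ = R at *
  generalize ⌊w ^ (j + 1)⌋₊ = R' at *
  generalize ⌊η * w ^ j⌋₊ = ℓ at *
  have hper : ∀ i, R + 1 < i → i + ℓ < R' → x i = x (i + ℓ) := fun i h1 h2 => by
    rw [hblock i h1 (by omega), hblock (i + ℓ) (by omega) h2,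
      show i + ℓ - R = i - R + ℓ by omega]
    simp only [Nat.dvd_add_self_right]
  have hend : x (R' - ℓ) ≠ x R' := by
    rw [hR']
    rcases hbetween (R' - ℓ) (by omega) (by omega) with h | h <;> rw [h]
    · exact hab
    · exact hbc.symm
  have hword : ∀ i, 1 ≤ i → i < ℓ → x (R + ℓ + i) = a := fun i h1 h2 => by
    rw [hblock _ (by omega) (by omega), if_neg]
    rw [show R + ℓ + i - R = i + ℓ by omega, Nat.dvd_add_self_right]
    exact Nat.not_dvd_of_pos_of_lt h1 h2
  have hc : x (R + ℓ + ℓ) = c := by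
    rw [hblock _ (by omega) (by omega), if_pos]
    rw [show R + ℓ + ℓ - R = ℓ + ℓ by omega, Nat.dvd_add_self_right]
  have hc' : x (R + ℓ) = c := by
    rw [hblock _ (by omega) (by omega), if_pos]
    rw [show R + ℓ - R = ℓ by omega]
  have ha' : x (R + 1 + ℓ) = a := by
    rw [← hword 1 le_rfl (by omega)]
    congr 1
    omega
  -- The preceding block may have left an overshooting `c` at `R + 1`. Without it the period extends
  -- back to `R + 1`, and `b` against `c` stops it at `R`; with it, `c` against `a` stops it at `R +
  -- 1`.
  rcases hbetween (R + 1) (by omega) (by omega) with h | h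
  · refine ⟨R, Or.inl rfl, ?_, fun i h1 h2 => ?_, hend, hword, hc⟩
    · rw [hR, hc']
      exact hbc
    · rcases Nat.lt_or_ge (R + 1) i with h3 | h3
      · exact hper i h3 h2
      · obtain rfl : i = R + 1 := by omega
        rw [h, ha']
  · refine ⟨R + 1, Or.inr rfl, ?_, fun i h1 h2 => hper i h1 h2, hend, hword, hc⟩
    rw [h, ha']
    exact hac.symm

/-- Each exception is determined by its block and its multiple of the period (multiple `0` for `b`),
and the number of periods in a block is bounded independently of the block. -/
theorem exists_exceptionCount_le {w η : ℝ} (hw : 4 ≤ w) (hη : 0 < η) (a b c : ℕ) :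
    ∃ M : ℕ, ∀ J : ℕ, exceptionCount (partQuot w η a b c) a ⌊w ^ J⌋₊ ≤ (J + 1) * (M + 1) := by
  classical
  refine ⟨⌊2 * (w + 1) / η⌋₊, fun J => ?_⟩
  set M := ⌊2 * (w + 1) / η⌋₊
  rw [← Finset.card_range (J + 1), ← Finset.card_range (M + 1), ← Finset.card_product]
  refine (Finset.card_le_card fun n hn => ?_).trans
    (Finset.card_image_le (f := fun p : ℕ × ℕ => ⌊w ^ p.1⌋₊ + p.2 * ⌊η * w ^ p.1⌋₊))
  rw [Finset.mem_filter, Finset.mem_Icc, partQuot_eq hw hη] at hn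
  obtain ⟨⟨hn1, hnJ⟩, hn⟩ := hn
  simp only [Finset.mem_image, Finset.mem_product, Finset.mem_range, Prod.exists]
  split_ifs at hn with h1 h2
  · obtain ⟨i, hi⟩ := h1
    refine ⟨i, 0, ⟨?_, by omega⟩, by rw [hi]; simp⟩
    have := (strictMono_floor_pow hw).le_iff_le.mp (hi ▸ hnJ)
    omega
  · obtain ⟨i, hi, hpos, m, hm, hni, hle⟩ := h2
    refine ⟨i, m, ⟨?_, ?_⟩, hni.symm⟩
    · have := (strictMono_floor_pow hw).le_iff_le.mp (show ⌊w ^ i⌋₊ ≤ ⌊w ^ J⌋₊ by omega)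
      omega
    · rw [Nat.lt_succ_iff, Nat.le_floor_iff (by positivity), le_div_iff₀ hη]
      have h1 : 1 ≤ w ^ i := one_le_pow₀ (by linarith)
      have h2 := Nat.floor_le (show 0 ≤ w ^ (i + 1) by positivity)
      have h3 := Nat.lt_floor_add_one (w ^ i)
      have h4 := Nat.lt_floor_add_one (η * w ^ i)
      have h5 : (1 : ℝ) ≤ (⌊η * w ^ i⌋₊ : ℝ) := by exact_mod_cast hpos
      have h6 : (⌊w ^ i⌋₊ : ℝ) + m * ⌊η * w ^ i⌋₊ ≤ ⌊w ^ (i + 1)⌋₊ + 1 := by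
        rw [hni] at hle
        exact_mod_cast hle
      have hm0 : (0 : ℝ) ≤ m := by positivity
      -- A real number whose floor is at least `1` is at most twice that floor.
      have h7 : (m : ℝ) * (η * w ^ i) ≤ 2 * (m * ⌊η * w ^ i⌋₊) := by nlinarith
      rw [pow_succ] at h2 h6
      have h8 : m * η * w ^ i ≤ 2 * (w + 1) * w ^ i := by nlinarith
      exact le_of_mul_le_mul_right h8 (by positivity)
  · exact absurd rfl hn

theorem exceptionCount_mono (x : ℕ → ℕ) (a : ℕ) : Monotone (exceptionCount x a) :=
  monotone_nat_of_le_succ fun n => by rw [exceptionCount_succ]; omega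

theorem exists_one_lt_sq_eq {a : ℕ} (ha : 0 < a) : ∃ θ : ℝ, 1 < θ ∧ θ ^ 2 = a * θ + 1 := by
  have ha1 : (1 : ℝ) ≤ a := by exact_mod_cast ha
  refine ⟨(a + √(a ^ 2 + 4)) / 2, ?_, ?_⟩
  · have : (a : ℝ) < √(a ^ 2 + 4) := Real.lt_sqrt_of_sq_lt (by linarith)
    have : (2 : ℝ) ≤ √(a ^ 2 + 4) := Real.le_sqrt_of_sq_le (by nlinarith)
    linarith
  · have := Real.sq_sqrt (show (0 : ℝ) ≤ a ^ 2 + 4 by positivity)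
    linear_combination this / 4

/-- The tolerance `3` lets a position be replaced by `w ^ j` or `(1 + η) w ^ j`: one unit each for
the start `r`, for the floor in the period length, and for an index shift. -/
theorem exists_abs_log_cfDen_sub_le {w η : ℝ} (hw : 4 ≤ w) (hη : 0 < η) {a b c : ℕ} (ha : 0 < a)
    (hb : 0 < b) (hc : 0 < c) : ∃ l : ℝ, 0 < l ∧ ∃ B : ℝ, 0 < B ∧ ∀ j n : ℕ,
      n ≤ ⌊w ^ (j + 1)⌋₊ → ∀ t : ℝ, |n - t| ≤ 3 →
      |Real.log (cfDen (partQuot w η a b c) (n + 1)) - l * t| ≤ B * (j + 1) := by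
  obtain ⟨θ, hθ, hθa⟩ := exists_one_lt_sq_eq ha
  obtain ⟨M, hM⟩ := exists_exceptionCount_le hw hη a b c
  have hl := Real.log_pos hθ
  have hK : (1 : ℝ) ≤ ((a + b + c : ℕ) : ℝ) := by exact_mod_cast (by omega)
  have hlK := Real.log_nonneg hK
  have hl2 := Real.log_nonneg one_le_two
  refine ⟨Real.log θ, hl, 2 * (M + 1) * Real.log ((a + b + c : ℕ) : ℝ) + Real.log 2 +
    3 * Real.log θ, by positivity, fun j n hn t ht => ?_⟩
  have h1 := abs_log_cfDen_sub_le (x := partQuot w η a b c) (partQuot_pos ha hb hc)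
    (partQuot_le w η a b c) ha (by omega) hθ hθa n
  have h2 : (exceptionCount (partQuot w η a b c) a n : ℝ) ≤ (j + 1 + 1) * (M + 1) := by
    exact_mod_cast (exceptionCount_mono _ a hn).trans (hM (j + 1))
  have h3 : (exceptionCount (partQuot w η a b c) a n : ℝ) * Real.log ((a + b + c : ℕ) : ℝ) ≤
      (j + 1 + 1) * (M + 1) * Real.log ((a + b + c : ℕ) : ℝ) := by gcongr
  have hj : (0 : ℝ) ≤ j := by positivity
  have h4 : (j + 1 + 1) * (M + 1) * Real.log ((a + b + c : ℕ) : ℝ) ≤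
      2 * (M + 1) * Real.log ((a + b + c : ℕ) : ℝ) * (j + 1) := by
    have : 0 ≤ (M + 1) * Real.log ((a + b + c : ℕ) : ℝ) := by positivity
    nlinarith
  have h5 : |(n : ℝ) * Real.log θ - Real.log θ * t| ≤ 3 * Real.log θ := by
    rw [mul_comm, ← mul_sub, abs_mul, abs_of_pos hl, mul_comm]
    gcongr
  calc |Real.log (cfDen (partQuot w η a b c) (n + 1)) - Real.log θ * t| ≤ _ :=
        abs_sub_le _ (n * Real.log θ) _
    _ ≤ _ := by nlinarith

/-! ### The quadratic approximations and their estimates -/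

set_option maxHeartbeats 1000000 in
theorem exists_quadratic_approximations {w η : ℝ} (hw : 4 ≤ w) (hη : 0 < η)
    (hηw : 1 + 2 * η < w) {a b c : ℕ} (ha : 0 < a) (hb : 0 < b) (hc : 0 < c) (hab : a ≠ b)
    (hac : a ≠ c) (hbc : b ≠ c) :
    ∃ l : ℝ, 0 < l ∧ ∃ B : ℝ, 0 < B ∧ ∀ᶠ j : ℕ in atTop, ∃ α : ℝ, ∃ Q : ℤ[X],
      Irrational α ∧ 0 ≤ α ∧ α ≤ 1 ∧ Q.natDegree ≤ 2 ∧ aeval α Q = 0 ∧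
      (∀ k : ℤ, C k ∣ Q → k ∣ (c : ℤ) - a) ∧
      (∀ i, |(Q.coeff i : ℝ)| ≤ Real.exp ((2 + η) * (l * w ^ j) + B * (j + 1))) ∧
      Real.exp ((2 + η) * (l * w ^ j) - B * (j + 1)) ≤ |(Q.coeff 2 : ℝ)| ∧
      Real.exp (-(2 * w) * (l * w ^ j) - B * (j + 1)) ≤ |cfVal (partQuot w η a b c) - α| ∧
      |cfVal (partQuot w η a b c) - α| ≤ Real.exp (-(2 * w) * (l * w ^ j) + B * (j + 1)) ∧
      Real.exp (-(2 * w - η) * (l * w ^ j) - B * (j + 1)) ≤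
        |aeval (cfVal (partQuot w η a b c)) Q| ∧
      |aeval (cfVal (partQuot w η a b c)) Q| ≤
        Real.exp (-(2 * w - η) * (l * w ^ j) + B * (j + 1)) := by
  obtain ⟨l, hl, B, hB, hD⟩ := exists_abs_log_cfDen_sub_le hw hη ha hb hc
  set K := a + b + c with hKdef
  have hx := partQuot_pos (w := w) (η := η) ha hb hc
  have hK := partQuot_le w η a b c
  have hgap := cfGap_pos K
  set G : ℝ := |Real.log (cfGap K / 16)| + |Real.log (1 / ((K : ℝ) + 2))| + Real.log 4 with hG
  have hl4 : 0 ≤ Real.log 4 := Real.log_nonneg (by norm_num)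
  have hG0 : 0 ≤ G := by positivity
  refine ⟨l, hl, 5 * B + G, by positivity, ?_⟩
  -- The three thresholds ensure, in order, a period of length at least `2`, indices large enough
  -- for `le_abs_cfDen_wedge`, and room for two periods in the block.
  have hlarge : ∀ᶠ j : ℕ in atTop, max (3 / η) (max 4 (4 / (w - 1 - 2 * η))) ≤ w ^ j :=
    (tendsto_pow_atTop_atTop_of_one_lt (by linarith)).eventually_ge_atTop _
  filter_upwards [hlarge, eventually_ge_atTop 1] with j hjw hj
  obtain ⟨hj1, hj2, hj3⟩ : 3 / η ≤ w ^ j ∧ 4 ≤ w ^ j ∧ 4 / (w - 1 - 2 * η) ≤ w ^ j := by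
    simpa using hjw
  rw [div_le_iff₀ hη] at hj1
  rw [div_le_iff₀ (by linarith)] at hj3
  have hwj : (0 : ℝ) ≤ w ^ j := by positivity
  have f1 := Nat.floor_le hwj
  have f1' := Nat.lt_floor_add_one (w ^ j)
  have f2 := Nat.floor_le (show 0 ≤ η * w ^ j by positivity)
  have f2' := Nat.lt_floor_add_one (η * w ^ j)
  have f3 := Nat.floor_le (show 0 ≤ w ^ (j + 1) by positivity)
  have f3' := Nat.lt_floor_add_one (w ^ (j + 1))
  have hpow : w ^ (j + 1) = w * w ^ j := pow_succ' w j
  have hℓ : 2 ≤ ⌊η * w ^ j⌋₊ := by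
    rw [Nat.le_floor_iff (by positivity)]
    push_cast
    linarith
  have hR3 : 4 ≤ ⌊w ^ j⌋₊ := by
    rw [Nat.le_floor_iff (by positivity)]
    exact_mod_cast hj2
  have hlong : ⌊w ^ j⌋₊ + 2 * ⌊η * w ^ j⌋₊ + 2 < ⌊w ^ (j + 1)⌋₊ := by
    have : (⌊w ^ j⌋₊ : ℝ) + 2 * ⌊η * w ^ j⌋₊ + 2 < ⌊w ^ (j + 1)⌋₊ := by nlinarith
    exact_mod_cast this
  obtain ⟨r, hr, hne, hper, hend, hword, hwc⟩ :=
    partQuot_structure hw hη hac hab hbc hj hℓ hlong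
  set x := partQuot w η a b c
  set R := ⌊w ^ j⌋₊
  set R' := ⌊w ^ (j + 1)⌋₊
  set ℓ := ⌊η * w ^ j⌋₊
  have hsr : r + ℓ - r = ℓ := by omega
  have hrR : (r : ℝ) - w ^ j ≤ 1 ∧ -1 ≤ (r : ℝ) - w ^ j := by
    rcases hr with h | h <;> rw [h]
    · constructor <;> linarith
    · push_cast
      constructor <;> linarith
  have D1 := hD j r (by omega) (w ^ j) (abs_le.mpr ⟨by linarith, by linarith⟩)
  have D2 := hD j (r - 1) (by omega) (w ^ j) (by
    rw [Nat.cast_sub (by omega)]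
    push_cast
    exact abs_le.mpr ⟨by linarith, by linarith⟩)
  have D3 := hD j (r + ℓ) (by omega) (w ^ j + η * w ^ j) (by
    push_cast
    exact abs_le.mpr ⟨by linarith, by linarith⟩)
  have D4 := hD j (r + ℓ - 1) (by omega) (w ^ j + η * w ^ j) (by
    rw [Nat.cast_sub (by omega)]
    push_cast
    exact abs_le.mpr ⟨by linarith, by linarith⟩)
  have D5 := hD j (R' - 1) (by omega) (w ^ (j + 1)) (by
    rw [Nat.cast_sub (by omega)]
    push_cast
    exact abs_le.mpr ⟨by linarith, by linarith⟩)
  rw [show r - 1 + 1 = r by omega] at D2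
  rw [show r + ℓ - 1 + 1 = r + ℓ by omega] at D4
  rw [show R' - 1 + 1 = R' by omega, hpow] at D5
  have hpos : ∀ n, 1 ≤ n → (0 : ℝ) < cfDen x n := fun n hn => by
    obtain ⟨n, rfl⟩ := Nat.exists_eq_add_of_le' hn
    exact_mod_cast cfDen_succ_pos hx n
  have E1 := Real.exp_log (hpos (r + 1) (by omega))
  have E2 := Real.exp_log (hpos r (by omega))
  have E3 := Real.exp_log (hpos (r + ℓ + 1) (by omega))
  have E4 := Real.exp_log (hpos (r + ℓ) (by omega))
  have E5 := Real.exp_log (hpos R' (by omega))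
  have b1 := fun i => abs_coeff_cfWedge_le hx (r := r) (s := r + ℓ) (by omega) (by omega) i
  have b2 := le_abs_cfDen_wedge hx hK (r := r) (s := r + ℓ) (by omega) (by omega) hne
  have b3 := abs_cfVal_sub_periodize_bounds hx hK (r := r) (s := r + ℓ) (R := R') (by omega)
    (by omega) (by rwa [hsr]) (by rwa [hsr])
  have b4 := aeval_cfWedge_bounds hx hK (r := r) (s := r + ℓ) (R := R') (by omega)
    (by omega) (by rwa [hsr]) (by rwa [hsr])
  have b1' : ∀ i, |((cfWedge x r (r + ℓ)).coeff i : ℝ)| ≤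
      2 * (cfDen x (r + 1) * cfDen x (r + ℓ + 1)) := fun i => by exact_mod_cast b1 i
  have hy : ∀ n, 0 < periodize x r (r + ℓ) n := fun n => by
    unfold periodize
    split_ifs <;> exact hx _
  have g1 := neg_abs_le (Real.log (cfGap K / 16))
  have g2 := neg_abs_le (Real.log (1 / ((K : ℝ) + 2)))
  have g0 := abs_nonneg (Real.log (cfGap K / 16))
  have g0' := abs_nonneg (Real.log (1 / ((K : ℝ) + 2)))
  have gj : G ≤ G * (j + 1) := by
    have : (0 : ℝ) ≤ j := by positivity
    nlinarith
  have c4 : (4 : ℝ) = Real.exp (Real.log 4) := (Real.exp_log (by norm_num)).symm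
  have cg : cfGap K / 16 = Real.exp (Real.log (cfGap K / 16)) :=
    (Real.exp_log (by positivity)).symm
  have cK : 1 / ((K : ℝ) + 2) = Real.exp (Real.log (1 / ((K : ℝ) + 2))) :=
    (Real.exp_log (by positivity)).symm
  have Bj : 0 < B * (j + 1) := by positivity
  rw [abs_le] at D1 D2 D3 D4 D5
  refine ⟨cfVal (periodize x r (r + ℓ)), cfWedge x r (r + ℓ), irrational_cfVal hy, cfVal_nonneg hy,
    cfVal_le_one hy, natDegree_cfWedge_le _ _ _, aeval_periodize hx (by omega), fun k hk => ?_,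
    fun i => (b1' i).trans ?_, le_trans ?_ ((coeff_cfWedge x r (r + ℓ)).2.2 ▸ b2),
    le_trans ?_ b3.1, b3.2.trans ?_, le_trans ?_ b4.1, b4.2.trans ?_⟩
  -- Moving the period to start after `R + ℓ` turns it into the word `a, …, a, c`, whose content is
  -- controlled.
  · have hk' : C k ∣ cfWedge x (R + ℓ) (R + ℓ + ℓ) := by
      have := cfWedge_add (x := x) (r := r) (s := r + ℓ) (m := R + ℓ - r) fun i hi => by
        rw [hper (r + i + 1) (by omega) (by omega)]
        congr 1
        omega
      rw [show r + (R + ℓ - r) = R + ℓ by omega, show r + ℓ + (R + ℓ - r) = R + ℓ + ℓ by omega]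
        at this
      rw [this]
      exact hk.mul_left _
    obtain ⟨k1, k2⟩ := dvd_cfDen_and_cfNum_of_C_dvd_cfWedge hk'
    exact dvd_sub_of_dvd_cfDen_of_dvd_cfNum (by omega) hword hwc k1 k2
  · calc _ ≤ 4 * ((cfDen x (r + 1) : ℝ) * cfDen x (r + ℓ + 1)) := by
          have := mul_pos (hpos (r + 1) (by omega)) (hpos (r + ℓ + 1) (by omega))
          linarith
      _ ≤ _ := by
          rw [← E1, ← E3, c4, ← Real.exp_add, ← Real.exp_add, Real.exp_le_exp]
          linarith
  · rw [← E2, ← E4, cK, ← Real.exp_add, ← Real.exp_add, Real.exp_le_exp]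
    linarith
  · calc _ ≤ cfGap K / 16 * (1 / (cfDen x R' : ℝ) ^ 2) := by
          rw [← E5, cg, one_div, ← Real.exp_nat_mul, ← Real.exp_neg, ← Real.exp_add,
            Real.exp_le_exp]
          push_cast
          linarith
      _ ≤ _ := by
          gcongr
          norm_num
  · rw [← E5, one_div, ← Real.exp_nat_mul, ← Real.exp_neg, Real.exp_le_exp]
    push_cast
    linarith
  · rw [← E1, ← E3, ← E5, cg, ← Real.exp_nat_mul, ← Real.exp_add, ← Real.exp_sub, ← Real.exp_add,
      Real.exp_le_exp]
    push_cast
    linarith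
  · rw [← E1, ← E3, ← E5, c4, ← Real.exp_nat_mul, ← Real.exp_add, ← Real.exp_sub, ← Real.exp_add,
      Real.exp_le_exp]
    push_cast
    linarith

/-! ### Heights, Mahler measure and Lipschitz bounds -/

theorem abs_coeff_le_polyHeight (P : ℤ[X]) (i : ℕ) : |(P.coeff i : ℝ)| ≤ polyHeight P := by
  by_cases h : P.coeff i = 0
  · simp [h]
  · have := Finset.le_sup (f := fun i => (P.coeff i).natAbs) (mem_support_iff.mpr h)
    rw [← Int.cast_abs, Int.abs_eq_natAbs]
    exact_mod_cast this

theorem polyHeight_le {P : ℤ[X]} {B : ℝ} (hB : 0 ≤ B) (h : ∀ i, |(P.coeff i : ℝ)| ≤ B) :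
    (polyHeight P : ℝ) ≤ B := by
  rw [← Nat.le_floor_iff hB]
  refine Finset.sup_le fun i _ => ?_
  rw [Nat.le_floor_iff hB]
  refine le_trans (le_of_eq ?_) (h i)
  rw [← Int.cast_abs, Int.abs_eq_natAbs]
  rfl

theorem one_le_polyHeight {P : ℤ[X]} (hP : P ≠ 0) : (1 : ℝ) ≤ polyHeight P := by
  refine le_trans ?_ (abs_coeff_le_polyHeight P P.natDegree)
  exact_mod_cast Int.one_le_abs (leadingCoeff_ne_zero.mpr hP)

theorem polyHeight_congr {P Q : ℤ[X]} (h : ∀ i, |P.coeff i| = |Q.coeff i|) :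
    polyHeight P = polyHeight Q := by
  have : ∀ i, |(P.coeff i : ℝ)| = |(Q.coeff i : ℝ)| := fun i => by exact_mod_cast h i
  exact_mod_cast le_antisymm
    (polyHeight_le (Nat.cast_nonneg _) fun i => (this i).le.trans (abs_coeff_le_polyHeight Q i))
    (polyHeight_le (Nat.cast_nonneg _) fun i => (this i).ge.trans (abs_coeff_le_polyHeight P i))

theorem Associated.eq_or_eq_neg_of_int {P Q : ℤ[X]} (h : Associated P Q) : Q = P ∨ Q = -P := by
  obtain ⟨u, rfl⟩ := h
  obtain ⟨r, hr, hu⟩ := Polynomial.isUnit_iff.mp u.isUnit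
  rcases Int.isUnit_iff.mp hr with rfl | rfl <;> simp [← hu]

/-- The Mahler measure of an integer polynomial. -/
noncomputable def intMahler (P : ℤ[X]) : ℝ := (P.map (Int.castRingHom ℂ)).mahlerMeasure

theorem one_le_intMahler {P : ℤ[X]} (hP : P ≠ 0) : 1 ≤ intMahler P :=
  one_le_mahlerMeasure_of_ne_zero hP

theorem intMahler_mul (P Q : ℤ[X]) : intMahler (P * Q) = intMahler P * intMahler Q := by
  unfold intMahler
  rw [Polynomial.map_mul, mahlerMeasure_mul]

theorem polyHeight_le_intMahler {P : ℤ[X]} {n : ℕ} (hn : P.natDegree ≤ n) :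
    (polyHeight P : ℝ) ≤ 2 ^ n * intMahler P := by
  have h0 : 0 ≤ intMahler P := mahlerMeasure_nonneg _
  refine polyHeight_le (by positivity) fun i => ?_
  have h := norm_coeff_le_choose_mul_mahlerMeasure i (P.map (Int.castRingHom ℂ))
  rw [natDegree_map_eq_of_injective (RingHom.injective_int _), coeff_map, eq_intCast,
    Complex.norm_intCast] at h
  refine h.trans ?_
  unfold intMahler at *
  gcongr
  calc ((P.natDegree.choose i : ℕ) : ℝ) ≤ 2 ^ P.natDegree := by
        exact_mod_cast Nat.choose_le_two_pow _ _
    _ ≤ 2 ^ n := pow_le_pow_right₀ one_le_two hn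

theorem intMahler_le {P : ℤ[X]} {n : ℕ} (hn : P.natDegree ≤ n) :
    intMahler P ≤ (n + 1) * polyHeight P := by
  refine (mahlerMeasure_le_sum_norm_coeff _).trans ?_
  rw [sum_over_range' _ (fun _ => norm_zero) (n + 1) (by
    rw [natDegree_map_eq_of_injective (RingHom.injective_int _)]; omega)]
  refine (Finset.sum_le_card_nsmul _ _ (polyHeight P : ℝ) fun i _ => ?_).trans ?_
  · rw [coeff_map, eq_intCast, Complex.norm_intCast]
    exact abs_coeff_le_polyHeight P i
  · simp

theorem finite_polyHeight_le (n : ℕ) (B : ℝ) :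
    {P : ℤ[X] | P.natDegree ≤ n ∧ (polyHeight P : ℝ) ≤ B}.Finite := by
  refine (finite_mahlerMeasure_le n ((n + 1) * B.toNNReal)).subset fun P hP => ⟨hP.1, ?_⟩
  refine (intMahler_le hP.1).trans ?_
  push_cast
  gcongr
  exact hP.2.trans (Real.le_coe_toNNReal B)

theorem norm_aeval_ofReal (P : ℤ[X]) (ξ : ℝ) : ‖aeval (ξ : ℂ) P‖ = |aeval ξ P| := by
  have : aeval (ξ : ℂ) P = ((aeval ξ P : ℝ) : ℂ) := by
    simpa using aeval_algebraMap_apply (B := ℂ) ξ P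
  rw [this, Complex.norm_real, Real.norm_eq_abs]

theorem norm_aeval_le {P : ℤ[X]} {n : ℕ} (hn : P.natDegree ≤ n) (z : ℂ) :
    ‖aeval z P‖ ≤ (n + 1) * polyHeight P * max 1 ‖z‖ ^ n := by
  rw [aeval_eq_sum_range' (show P.natDegree < n + 1 by omega)]
  refine (norm_sum_le _ _).trans ?_
  refine (Finset.sum_le_card_nsmul _ _ (polyHeight P * max 1 ‖z‖ ^ n : ℝ) fun i hi => ?_).trans ?_
  · rw [zsmul_eq_mul, norm_mul, norm_pow, Complex.norm_intCast]
    rw [Finset.mem_range] at hi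
    gcongr
    · exact abs_coeff_le_polyHeight P i
    · exact (pow_le_pow_left₀ (norm_nonneg z) (le_max_right _ _) i).trans
        (pow_le_pow_right₀ (le_max_left _ _) (by omega))
  · simp [mul_assoc]

theorem norm_pow_sub_pow_le {z w : ℂ} (hz : ‖z‖ ≤ 2) (hw : ‖w‖ ≤ 2) (i : ℕ) :
    ‖z ^ i - w ^ i‖ ≤ i * 2 ^ i * ‖z - w‖ := by
  induction i with
  | zero => simp
  | succ i ih =>
    have e : z ^ (i + 1) - w ^ (i + 1) = z ^ i * (z - w) + (z ^ i - w ^ i) * w := by ring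
    have h1 : ‖z‖ ^ i ≤ 2 ^ i := pow_le_pow_left₀ (norm_nonneg z) hz i
    rw [e]
    refine (norm_add_le _ _).trans ?_
    rw [norm_mul, norm_mul, norm_pow]
    have h2 : ‖z ^ i - w ^ i‖ * ‖w‖ ≤ i * 2 ^ i * ‖z - w‖ * 2 := by gcongr
    have h3 : ‖z‖ ^ i * ‖z - w‖ ≤ 2 ^ i * ‖z - w‖ := by gcongr
    have h4 : 0 ≤ 2 ^ i * ‖z - w‖ := by positivity
    push_cast
    rw [pow_succ]
    nlinarith

/-- A Lipschitz constant, relative to the height, for integer polynomials of degree at most `n` on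
the disc of radius `2`. -/
noncomputable def lipConst (n : ℕ) : ℝ := (n + 1) * (n * 2 ^ n) + 1

theorem lipConst_pos (n : ℕ) : 0 < lipConst n := by unfold lipConst; positivity

theorem norm_aeval_sub_le {P : ℤ[X]} {n : ℕ} (hn : P.natDegree ≤ n) {z w : ℂ} (hz : ‖z‖ ≤ 2)
    (hw : ‖w‖ ≤ 2) : ‖aeval z P - aeval w P‖ ≤ lipConst n * polyHeight P * ‖z - w‖ := by
  rw [aeval_eq_sum_range' (show P.natDegree < n + 1 by omega),
    aeval_eq_sum_range' (show P.natDegree < n + 1 by omega), ← Finset.sum_sub_distrib]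
  refine (norm_sum_le _ _).trans ?_
  refine (Finset.sum_le_card_nsmul _ _ (polyHeight P * (n * 2 ^ n * ‖z - w‖) : ℝ)
    fun i hi => ?_).trans ?_
  · rw [← smul_sub, zsmul_eq_mul, norm_mul, Complex.norm_intCast]
    rw [Finset.mem_range] at hi
    gcongr
    · exact abs_coeff_le_polyHeight P i
    · refine (norm_pow_sub_pow_le hz hw i).trans ?_
      have : (i : ℝ) ≤ n := by exact_mod_cast (by omega)
      gcongr
      · exact one_le_two
      · omega
  · unfold lipConst
    simp only [Finset.card_range, nsmul_eq_mul]
    push_cast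
    have : 0 ≤ (polyHeight P : ℝ) * ‖z - w‖ := by positivity
    linarith

/-! ### Integral minimal polynomials and the Liouville inequality -/

theorem intMinpoly_spec {α : ℂ} (hα : IsAlgebraic ℚ α) :
    (intMinpoly α).IsPrimitive ∧
    Associated ((intMinpoly α).map (algebraMap ℤ ℚ)) (minpoly ℚ α) := by
  have hm : minpoly ℚ α ≠ 0 := minpoly.ne_zero hα.isIntegral
  refine ⟨isPrimitive_primPart _, ?_⟩
  set N := IsLocalization.integerNormalization (nonZeroDivisors ℤ) (minpoly ℚ α) with hN
  obtain ⟨b, hb, hbN⟩ := IsLocalization.integerNormalization_spec (nonZeroDivisors ℤ) (minpoly ℚ α)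
  rw [← hN] at hbN
  have hb0 : (b : ℚ) ≠ 0 := by exact_mod_cast nonZeroDivisors.ne_zero hb
  have hN0 : N ≠ 0 := by
    rw [hN, Ne, IsLocalization.integerNormalization_eq_zero_iff le_rfl]
    exact hm
  have hc0 : (N.content : ℚ) ≠ 0 := by exact_mod_cast content_eq_zero_iff.not.mpr hN0
  have e : C (N.content : ℚ) * (intMinpoly α).map (algebraMap ℤ ℚ) = C (b : ℚ) * minpoly ℚ α := by
    have h1 := congrArg (Polynomial.map (algebraMap ℤ ℚ)) N.eq_C_content_mul_primPart
    rw [hbN, Polynomial.map_mul, map_C] at h1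
    rw [← smul_eq_C_mul (b : ℚ), Int.cast_smul_eq_zsmul, h1]
    rfl
  have u1 : IsUnit (C (N.content : ℚ)) := isUnit_C.mpr (isUnit_iff_ne_zero.mpr hc0)
  have u2 : IsUnit (C (b : ℚ)) := isUnit_C.mpr (isUnit_iff_ne_zero.mpr hb0)
  have a1 := associated_unit_mul_left ((intMinpoly α).map (algebraMap ℤ ℚ)) _ u1
  have a2 := associated_unit_mul_left (minpoly ℚ α) _ u2
  rw [e] at a1
  exact a1.symm.trans a2

theorem intMinpoly_ne_zero {α : ℂ} (hα : IsAlgebraic ℚ α) : intMinpoly α ≠ 0 :=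
  (intMinpoly_spec hα).1.ne_zero

theorem irreducible_intMinpoly {α : ℂ} (hα : IsAlgebraic ℚ α) : Irreducible (intMinpoly α) := by
  obtain ⟨h1, h2⟩ := intMinpoly_spec hα
  rw [h1.irreducible_iff_irreducible_map_fraction_map (K := ℚ), h2.irreducible_iff]
  exact minpoly.irreducible hα.isIntegral

theorem natDegree_intMinpoly {α : ℂ} (hα : IsAlgebraic ℚ α) :
    (intMinpoly α).natDegree = (minpoly ℚ α).natDegree := by
  rw [← natDegree_map_eq_of_injective (FaithfulSMul.algebraMap_injective ℤ ℚ) (intMinpoly α)]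
  exact natDegree_eq_of_degree_eq (degree_eq_degree_of_associated (intMinpoly_spec hα).2)

theorem aeval_intMinpoly {α : ℂ} (hα : IsAlgebraic ℚ α) : aeval α (intMinpoly α) = 0 := by
  obtain ⟨q, hq⟩ := (intMinpoly_spec hα).2.symm.dvd
  rw [← aeval_map_algebraMap ℚ, hq, map_mul, minpoly.aeval, zero_mul]

theorem intMinpoly_dvd {α : ℂ} (hα : IsAlgebraic ℚ α) {P : ℤ[X]} (hP : aeval α P = 0) :
    intMinpoly α ∣ P := by
  obtain ⟨h1, h2⟩ := intMinpoly_spec hα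
  refine h1.dvd_of_fraction_map_dvd_fraction_map (K := ℚ) (h2.dvd.trans ?_)
  exact minpoly.dvd ℚ α (by rwa [aeval_map_algebraMap])

theorem resultant_ne_zero_of_not_associated {f P : ℤ[X]} (hf : Irreducible f) (hP : Irreducible P)
    (hfp : f.IsPrimitive) (h : ¬Associated f P) : resultant f P ≠ 0 := by
  have hinj := FaithfulSMul.algebraMap_injective ℤ ℚ
  have hcop : IsCoprime (f.map (algebraMap ℤ ℚ)) (P.map (algebraMap ℤ ℚ)) := by
    have hf' := (hfp.irreducible_iff_irreducible_map_fraction_map (K := ℚ)).mp hf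
    rw [hf'.coprime_iff_not_dvd]
    intro hd
    exact h (hf.associated_of_dvd hP (hfp.dvd_of_fraction_map_dvd_fraction_map hd))
  have := resultant_ne_zero _ _ hcop
  rw [natDegree_map_eq_of_injective hinj, natDegree_map_eq_of_injective hinj,
    resultant_map_map] at this
  intro h0
  rw [h0, map_zero] at this
  exact this rfl

theorem exists_roots_eq_pair {p : ℂ[X]} (hp : p.natDegree = 2) {α : ℂ} (hα : α ∈ p.roots) :
    ∃ β, p.roots = {α, β} := by
  have hc : p.roots.card = 2 := by rw [← hp]; exact IsAlgClosed.card_roots_eq_natDegree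
  obtain ⟨t, ht⟩ := Multiset.exists_cons_of_mem hα
  rw [ht, Multiset.card_cons] at hc
  obtain ⟨β, rfl⟩ := Multiset.card_eq_one.mp (show t.card = 1 by omega)
  exact ⟨β, ht⟩

/-- A Liouville inequality: the value of an irreducible integer polynomial at a quadratic number
that is not one of its roots. -/
theorem one_le_norm_aeval_mul {f P : ℤ[X]} (hf : Irreducible f) (hP : Irreducible P)
    (hfp : f.IsPrimitive) (hdeg : f.natDegree = 2) (h : ¬Associated f P) {n : ℕ}
    (hn : P.natDegree ≤ n) {α : ℂ} (hα : aeval α f = 0) :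
    1 ≤ ‖aeval α P‖ * ((n + 1) * polyHeight P * intMahler f ^ n) := by
  have hinj : Function.Injective (Int.castRingHom ℂ) := RingHom.injective_int _
  have hres := resultant_ne_zero_of_not_associated hf hP hfp h
  set F := f.map (Int.castRingHom ℂ) with hF
  have hFdeg : F.natDegree = 2 := by rw [hF, natDegree_map_eq_of_injective hinj, hdeg]
  have hF0 : F ≠ 0 := fun h0 => by rw [h0] at hFdeg; simp at hFdeg
  have hαF : α ∈ F.roots := by
    rw [mem_roots hF0, IsRoot.def, hF, eval_map]
    exact hα
  obtain ⟨β, hroots⟩ := exists_roots_eq_pair hFdeg hαF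
  have e1 := resultant_eq_prod_eval F (P.map (Int.castRingHom ℂ)) P.natDegree
    natDegree_map_le (IsAlgClosed.splits F)
  have e2 : F.resultant (P.map (Int.castRingHom ℂ)) F.natDegree P.natDegree =
      ((resultant f P : ℤ) : ℂ) := by
    rw [hF, natDegree_map_eq_of_injective hinj, resultant_map_map]
    rfl
  rw [e2, hroots] at e1
  have ev : ∀ z : ℂ, eval z (P.map (Int.castRingHom ℂ)) = aeval z P := fun z => by
    rw [eval_map]; rfl
  have hM : intMahler f = ‖F.leadingCoeff‖ * (max 1 ‖α‖ * max 1 ‖β‖) := by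
    unfold intMahler
    rw [mahlerMeasure_eq_leadingCoeff_mul_prod_roots, ← hF, hroots]
    simp
  have h1 : (1 : ℝ) ≤ ‖((resultant f P : ℤ) : ℂ)‖ := by
    rw [Complex.norm_intCast]
    exact_mod_cast Int.one_le_abs hres
  have hMf := one_le_intMahler hf.ne_zero
  set k := P.natDegree with hk
  -- The resultant is the leading coefficient to the power `k` times `P(α) P(β)`. The factor `P(β)`
  -- is bounded trivially, and the Mahler measure of `f` absorbs the leading coefficient together
  -- with `max 1 ‖β‖`.
  calc (1 : ℝ) ≤ _ := h1
    _ = ‖F.leadingCoeff‖ ^ k * (‖aeval α P‖ * ‖aeval β P‖) := by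
        rw [e1]
        simp [ev]
    _ ≤ ‖F.leadingCoeff‖ ^ k * (‖aeval α P‖ * ((k + 1) * polyHeight P * max 1 ‖β‖ ^ k)) := by
        gcongr
        exact norm_aeval_le le_rfl β
    _ = ‖aeval α P‖ * ((k + 1) * polyHeight P * (‖F.leadingCoeff‖ * (1 * max 1 ‖β‖)) ^ k) := by
        rw [one_mul, mul_pow]
        ring
    _ ≤ ‖aeval α P‖ * ((k + 1) * polyHeight P * intMahler f ^ k) := by
        rw [hM]
        gcongr
        exact le_max_left _ _
    _ ≤ _ := by
        have : (k : ℝ) ≤ n := by exact_mod_cast hn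
        gcongr

/-! ### Passing to minimal polynomials -/

/-- A real quadratic number `α` approximating `ξ`: at scale `T`, and up to errors `E` in the
exponents, its height is `exp ((2 + η) T)`, its distance to `ξ` is `exp (-2 w T)`, and its minimal
polynomial takes the value `exp (-(2 w - η) T)` at `ξ`. -/
structure IsQuadApprox (ξ w η T E α : ℝ) : Prop where
  nonneg : 0 ≤ α
  le_one : α ≤ 1
  isAlgebraic : IsAlgebraic ℚ (α : ℂ)
  natDegree_eq : (intMinpoly (α : ℂ)).natDegree = 2
  le_height : Real.exp ((2 + η) * T - E) ≤ polyHeight (intMinpoly (α : ℂ))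
  height_le : (polyHeight (intMinpoly (α : ℂ)) : ℝ) ≤ Real.exp ((2 + η) * T + E)
  le_dist : Real.exp (-(2 * w) * T - E) ≤ |ξ - α|
  dist_le : |ξ - α| ≤ Real.exp (-(2 * w) * T + E)
  le_aeval : Real.exp (-(2 * w - η) * T - E) ≤ |aeval ξ (intMinpoly (α : ℂ))|
  aeval_le : |aeval ξ (intMinpoly (α : ℂ))| ≤ Real.exp (-(2 * w - η) * T + E)

theorem aeval_ofReal_eq_zero {P : ℤ[X]} {α : ℝ} (h : aeval α P = 0) : aeval (α : ℂ) P = 0 := by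
  rw [← norm_eq_zero, norm_aeval_ofReal, h, abs_zero]

theorem natDegree_minpoly_of_irrational {α : ℝ} (hirr : Irrational α)
    (hα : IsAlgebraic ℚ (α : ℂ)) : 2 ≤ (minpoly ℚ (α : ℂ)).natDegree := by
  rw [minpoly.two_le_natDegree_iff hα.isIntegral]
  rintro ⟨q, hq⟩
  apply hirr
  refine ⟨q, ?_⟩
  have : ((q : ℝ) : ℂ) = (α : ℂ) := by
    rw [← hq]
    simp
  exact_mod_cast this

/-- Irrationality of `α` and the degree bound force `Q` to be an integer multiple of the minimal
polynomial. The integer divides `Q`, hence is at most `k`, and costs `log k` in the error. -/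
theorem isQuadApprox_of_quadratic {ξ w η T E α k : ℝ} {Q : ℤ[X]} (hk : 1 ≤ k)
    (hirr : Irrational α) (h0 : 0 ≤ α) (h1 : α ≤ 1) (hQ : Q.natDegree ≤ 2) (hαQ : aeval α Q = 0)
    (hc : ∀ m : ℤ, C m ∣ Q → |(m : ℝ)| ≤ k)
    (hcoeff : ∀ i, |(Q.coeff i : ℝ)| ≤ Real.exp ((2 + η) * T + E))
    (hlead : Real.exp ((2 + η) * T - E) ≤ |(Q.coeff 2 : ℝ)|)
    (hd : Real.exp (-(2 * w) * T - E) ≤ |ξ - α|) (hd' : |ξ - α| ≤ Real.exp (-(2 * w) * T + E))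
    (hv : Real.exp (-(2 * w - η) * T - E) ≤ |aeval ξ Q|)
    (hv' : |aeval ξ Q| ≤ Real.exp (-(2 * w - η) * T + E)) :
    IsQuadApprox ξ w η T (E + Real.log k) α := by
  have hlk := Real.log_nonneg hk
  have hk0 : 0 < k := by linarith
  have hQ2 : (Q.coeff 2 : ℝ) ≠ 0 := abs_pos.mp ((Real.exp_pos _).trans_le hlead)
  have hQ0 : Q ≠ 0 := by
    rintro rfl
    simp at hQ2
  have hαQ' := aeval_ofReal_eq_zero hαQ
  have halg : IsAlgebraic ℚ (α : ℂ) :=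
    (show IsAlgebraic ℤ (α : ℂ) from ⟨Q, hQ0, hαQ'⟩).extendScalars
      (FaithfulSMul.algebraMap_injective ℤ ℚ)
  set f := intMinpoly (α : ℂ) with hf
  obtain ⟨g, hg⟩ := intMinpoly_dvd halg hαQ'
  rw [← hf] at hg
  have hf2 : 2 ≤ f.natDegree := by
    rw [hf, natDegree_intMinpoly halg]
    exact natDegree_minpoly_of_irrational hirr halg
  have hf0 : f ≠ 0 := intMinpoly_ne_zero halg
  have hg0 : g ≠ 0 := by
    rintro rfl
    simp [hg] at hQ0
  have hdeg : Q.natDegree = f.natDegree + g.natDegree := by rw [hg, natDegree_mul hf0 hg0]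
  have hgC : g = C (g.coeff 0) := eq_C_of_natDegree_eq_zero (by omega)
  set m := g.coeff 0 with hm
  have hm0 : m ≠ 0 := by
    intro h
    rw [h, map_zero] at hgC
    exact hg0 hgC
  have hmk : |(m : ℝ)| ≤ k := hc m ⟨f, by rw [hg, hgC, mul_comm]⟩
  have hm1 : (1 : ℝ) ≤ |(m : ℝ)| := by exact_mod_cast Int.one_le_abs hm0
  have hco : ∀ i, |(Q.coeff i : ℝ)| = |(f.coeff i : ℝ)| * |(m : ℝ)| := fun i => by
    rw [hg, hgC, coeff_mul_C, Int.cast_mul, abs_mul]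
  have hval : |aeval ξ Q| = |aeval ξ f| * |(m : ℝ)| := by
    rw [hg, hgC, map_mul, abs_mul]
    simp
  have hexp : ∀ u : ℝ, Real.exp (u - (E + Real.log k)) * k = Real.exp (u - E) := fun u => by
    rw [← sub_sub, Real.exp_sub, Real.exp_log hk0]
    field_simp
  have hexp' : ∀ u : ℝ, Real.exp (u + E) ≤ Real.exp (u + (E + Real.log k)) := fun u =>
    Real.exp_le_exp.mpr (by linarith)
  refine ⟨h0, h1, halg, show f.natDegree = 2 by omega, ?_, ?_, ?_, hd'.trans (hexp' _), ?_, ?_⟩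
  · refine le_trans ?_ (abs_coeff_le_polyHeight f 2)
    refine le_of_mul_le_mul_right ?_ hk0
    rw [hexp]
    refine hlead.trans ?_
    rw [hco]
    gcongr
  · refine (polyHeight_le (Real.exp_pos _).le fun i => ?_).trans (hexp' _)
    refine le_trans ?_ (hcoeff i)
    rw [hco]
    exact le_mul_of_one_le_right (abs_nonneg _) hm1
  · exact (Real.exp_le_exp.mpr (by linarith)).trans hd
  · refine le_of_mul_le_mul_right ?_ hk0
    rw [hexp]
    refine hv.trans ?_
    rw [hval]
    gcongr
  · refine le_trans ?_ (hv'.trans (hexp' _))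
    rw [hval]
    exact le_mul_of_one_le_right (abs_nonneg _) hm1

theorem exists_isQuadApprox {w η : ℝ} (hw : 4 ≤ w) (hη : 0 < η)
    (hηw : 1 + 2 * η < w) {a b c : ℕ} (ha : 0 < a) (hb : 0 < b) (hc : 0 < c) (hab : a ≠ b)
    (hac : a ≠ c) (hbc : b ≠ c) :
    ∃ l : ℝ, 0 < l ∧ ∀ ε : ℝ, 0 < ε → ∀ᶠ j : ℕ in atTop, ∃ α : ℝ,
      IsQuadApprox (cfVal (partQuot w η a b c)) w η (l * w ^ j) (ε * (l * w ^ j)) α := by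
  obtain ⟨l, hl, B, hB, hj⟩ := exists_quadratic_approximations hw hη hηw ha hb hc hab hac hbc
  refine ⟨l, hl, fun ε hε => ?_⟩
  have hca : (c : ℤ) - a ≠ 0 := sub_ne_zero.mpr (by exact_mod_cast hac.symm)
  obtain ⟨z, hz⟩ : ∃ z : ℤ, z = (c : ℤ) - a := ⟨_, rfl⟩
  rw [← hz] at hca
  simp only [← hz] at hj
  set k : ℝ := |(z : ℝ)| with hk
  have hk1 : 1 ≤ k := by
    rw [hk]
    exact_mod_cast Int.one_le_abs hca
  have hlk := Real.log_nonneg hk1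
  have hlim : ∀ᶠ j : ℕ in atTop, (B + Real.log k) * (j + 1) ≤ ε * (l * w ^ j) := by
    have h1 : Tendsto (fun j : ℕ => ((j : ℝ) + 1) / w ^ j) atTop (𝓝 0) := by
      have h2 := tendsto_pow_const_div_const_pow_of_one_lt 1 (show 1 < w by linarith)
      have h3 := tendsto_pow_const_div_const_pow_of_one_lt 0 (show 1 < w by linarith)
      simpa [add_div] using h2.add h3
    have hpos : 0 < ε * l / (B + Real.log k) := by positivity
    filter_upwards [h1.eventually_lt_const hpos] with j hjlt
    have hwj : 0 < w ^ j := by positivity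
    rw [div_lt_div_iff₀ hwj (by positivity)] at hjlt
    linarith
  filter_upwards [hj, hlim] with j ⟨α, Q, h1, h2, h3, h4, h5, h6, h7, h8, h9, h10, h11, h12⟩ hlimj
  have key := isQuadApprox_of_quadratic hk1 h1 h2 h3 h4 h5 (fun m hm => by
    have := Int.natAbs_le_of_dvd_ne_zero (h6 m hm) hca
    rw [hk, ← Int.cast_abs, ← Int.cast_abs, Int.abs_eq_natAbs, Int.abs_eq_natAbs]
    exact_mod_cast this) h7 h8 h9 h10 h11 h12
  have hE : B * ((j : ℝ) + 1) + Real.log k ≤ ε * (l * w ^ j) := by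
    refine le_trans ?_ hlimj
    have : (0 : ℝ) ≤ j := by positivity
    nlinarith
  obtain ⟨k1, k2, k3, k4, k5, k6, k7, k8, k9, k10⟩ := key
  refine ⟨α, k1, k2, k3, k4, le_trans (Real.exp_le_exp.mpr ?_) k5,
    k6.trans (Real.exp_le_exp.mpr ?_), le_trans (Real.exp_le_exp.mpr ?_) k7,
    k8.trans (Real.exp_le_exp.mpr ?_), le_trans (Real.exp_le_exp.mpr ?_) k9,
    k10.trans (Real.exp_le_exp.mpr ?_)⟩ <;> linarith

/-! ### Lower bounds away from the approximations -/

/-- A lower bound for the value at `ξ` of an irreducible polynomial of moderate height. -/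
theorem IsQuadApprox.le_aeval_of_not_associated {ξ w η T ε α : ℝ} {d : ℕ} (h0 : 0 ≤ ξ)
    (h1 : ξ ≤ 1) (hq : IsQuadApprox ξ w η T (ε * T) α) {P : ℤ[X]} (hP : Irreducible P)
    (hdeg : P.natDegree ≤ d) (hna : ¬Associated (intMinpoly (α : ℂ)) P)
    (hT : 2 * Real.log (polyHeight P) + (d * (2 + η + ε) + ε - 2 * w) * T +
      (Real.log (d + 1) + d * Real.log 3 + Real.log (lipConst d) + Real.log 2) ≤ 0) :
    Real.exp (-(Real.log (polyHeight P) + d * (2 + η + ε) * T +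
      (Real.log (d + 1) + d * Real.log 3 + Real.log 2))) ≤ |aeval ξ P| := by
  have hH1 := one_le_polyHeight hP.ne_zero
  have hH0 : (0 : ℝ) < polyHeight P := by linarith
  have hd0 : (0 : ℝ) < (d : ℝ) + 1 := by positivity
  have eH := Real.exp_log hH0
  have ed := Real.exp_log hd0
  have e3 := Real.exp_log (show (0 : ℝ) < 3 by norm_num)
  have e2 := Real.exp_log (show (0 : ℝ) < 2 by norm_num)
  have el := Real.exp_log (lipConst_pos d)
  have hL := one_le_norm_aeval_mul (irreducible_intMinpoly hq.isAlgebraic) hP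
    (intMinpoly_spec hq.isAlgebraic).1 hq.natDegree_eq hna hdeg (aeval_intMinpoly hq.isAlgebraic)
  have hM : intMahler (intMinpoly (α : ℂ)) ≤ Real.exp (Real.log 3 + ((2 + η) * T + ε * T)) := by
    rw [Real.exp_add, e3]
    have := intMahler_le (n := 2) hq.natDegree_eq.le
    push_cast at this
    nlinarith [hq.height_le]
  have hM0 : 0 ≤ intMahler (intMinpoly (α : ℂ)) := Polynomial.mahlerMeasure_nonneg _
  rw [norm_aeval_ofReal] at hL
  obtain ⟨X, hX⟩ : ∃ X, X = Real.log (polyHeight P) + d * (2 + η + ε) * T +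
    (Real.log (d + 1) + d * Real.log 3) := ⟨_, rfl⟩
  have hL' : Real.exp (-X) ≤ |aeval α P| := by
    rw [Real.exp_neg, inv_le_iff_one_le_mul₀ (Real.exp_pos _)]
    refine hL.trans ?_
    gcongr
    calc _ ≤ ((d : ℝ) + 1) * polyHeight P * Real.exp (Real.log 3 + ((2 + η) * T + ε * T)) ^ d := by
          gcongr
      _ = Real.exp X := by
          rw [← Real.exp_nat_mul, show X = Real.log (d + 1) + Real.log (polyHeight P) +
            d * (Real.log 3 + ((2 + η) * T + ε * T)) by rw [hX]; ring, Real.exp_add (_ + _),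
            Real.exp_add, ed, eH]
  have n1 : ‖(ξ : ℂ)‖ ≤ 2 := by
    rw [Complex.norm_real, Real.norm_eq_abs, abs_of_nonneg h0]; linarith
  have n2 : ‖(α : ℂ)‖ ≤ 2 := by
    rw [Complex.norm_real, Real.norm_eq_abs, abs_of_nonneg hq.nonneg]; linarith [hq.le_one]
  have hdiff := norm_aeval_sub_le hdeg n1 n2
  rw [← Complex.ofReal_sub, Complex.norm_real, Real.norm_eq_abs] at hdiff
  -- The hypothesis `hT` says precisely that the Lipschitz error is at most half the lower bound
  -- `exp (-X)` for `|P(α)|`.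
  have hdiff' : lipConst d * polyHeight P * |ξ - α| ≤ Real.exp (-(X + Real.log 2)) := by
    calc _ ≤ lipConst d * polyHeight P * Real.exp (-(2 * w) * T + ε * T) := by
          have := lipConst_pos d
          have := hq.dist_le
          gcongr
      _ = Real.exp (Real.log (lipConst d) + Real.log (polyHeight P) +
            (-(2 * w) * T + ε * T)) := by
          rw [Real.exp_add (Real.log _ + _), Real.exp_add (Real.log _), el, eH]
      _ ≤ _ := by
          rw [Real.exp_le_exp, hX]
          linarith
  have htri : |aeval α P| - |aeval ξ P| ≤ ‖aeval (ξ : ℂ) P - aeval (α : ℂ) P‖ := by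
    rw [← norm_aeval_ofReal, ← norm_aeval_ofReal, norm_sub_rev]
    exact norm_sub_norm_le _ _
  have hhalf : Real.exp (-X) = 2 * Real.exp (-(X + Real.log 2)) := by
    rw [neg_add X, Real.exp_add, Real.exp_neg (Real.log 2), e2]
    ring
  have : -(Real.log (polyHeight P) + d * (2 + η + ε) * T +
      (Real.log (d + 1) + d * Real.log 3 + Real.log 2)) = -(X + Real.log 2) := by
    rw [hX]; ring
  rw [this]
  linarith

/-- Along a sequence of quadratic approximations to `ξ`, every irreducible polynomial that is not
one of their minimal polynomials takes a not too small value at `ξ`. -/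
theorem exists_le_aeval_of_not_associated {ξ w η l ε : ℝ} {d : ℕ} (h0 : 0 ≤ ξ) (h1 : ξ ≤ 1)
    (hl : 0 < l) (hη : 0 < η) (hd : 2 ≤ d) (hdw : d * (2 + η) ^ 2 ≤ 7 / 10 * w) (hw : 11 ≤ w)
    (hε : 0 < ε) (hε' : ε ≤ 1 / 4) {α : ℕ → ℝ} {J : ℕ}
    (hq : ∀ j ≥ J, IsQuadApprox ξ w η (l * w ^ j) (ε * (l * w ^ j)) (α j))
    (hJ : 2 * (Real.log (d + 1) + d * Real.log 3 + Real.log (lipConst d) + Real.log 2) ≤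
      w * (l * w ^ J)) :
    ∃ A : ℝ, 0 ≤ A ∧ ∀ P : ℤ[X], Irreducible P → P.natDegree ≤ d →
      (∀ j ≥ J, ¬Associated (intMinpoly (α j : ℂ)) P) →
      Real.exp (-((2 * w - 2 - η) / (2 + η) * Real.log (polyHeight P) + A)) ≤ |aeval ξ P| := by
  have hd1 : (2 : ℝ) ≤ d := by exact_mod_cast hd
  set D := d * (2 + η + ε) with hD
  set c := Real.log (d + 1) + d * Real.log 3 + Real.log 2 with hc
  have hc0 : 0 ≤ c := by
    have := Real.log_nonneg (show (1 : ℝ) ≤ d + 1 by linarith)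
    have := Real.log_nonneg (show (1 : ℝ) ≤ 3 by norm_num)
    have := Real.log_nonneg one_le_two
    positivity
  have hD0 : 0 < D := by positivity
  have hdη : d * (2 + η) ≤ 7 / 20 * w := by nlinarith
  have hd4 : (d : ℝ) ≤ 7 / 40 * w := by
    have : 4 ≤ (2 + η) ^ 2 := by nlinarith
    nlinarith
  have hdε : d * ε ≤ d * (1 / 4) := by gcongr
  have hDw : D + ε ≤ w / 2 := by
    rw [hD, mul_add]
    linarith
  have hT0 : ∀ j : ℕ, 0 < l * w ^ j := fun j => by positivity
  have hTmono : ∀ j ≥ J, l * w ^ J ≤ l * w ^ j := fun j hj => by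
    gcongr
    linarith
  set W := (2 * w - 2 - η) / (2 + η) with hW
  -- The dominant term on the left, after multiplication by `2 + η`, is `2 d (2 + η) ^ 2 ≤ 7 / 5 *
  -- w`; the rest fits below `2 * w`. This is where the size of `w` is needed.
  have hDW : 1 + 2 * D ≤ W := by
    rw [hW, le_div_iff₀ (by linarith)]
    have e : d * ε * (2 + η) ≤ 7 / 80 * w := by nlinarith
    have e' : 2 + η ≤ 7 / 40 * w := by nlinarith
    nlinarith
  refine ⟨D * (l * w ^ J) + c, by have := hT0 J; positivity, fun P hP hdeg hna => ?_⟩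
  have hh := Real.log_nonneg (one_le_polyHeight hP.ne_zero)
  set h := Real.log (polyHeight P)
  -- The least such `j` is used: the upper bound on `h` makes `α j` close enough to `ξ`, while
  -- minimality gives `l * w ^ j < 2 * h` if `j > J`, so that the height of `α j` costs at most `2 *
  -- D * h`.
  have hex : ∃ j, J ≤ j ∧ h ≤ w / 2 * (l * w ^ j) := by
    have : Tendsto (fun j : ℕ => w / 2 * (l * w ^ j)) atTop atTop :=
      ((tendsto_pow_atTop_atTop_of_one_lt (by linarith)).const_mul_atTop hl).const_mul_atTop
        (by linarith)
    obtain ⟨j, hj1, hj2⟩ := ((eventually_ge_atTop J).and (this.eventually_ge_atTop h)).exists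
    exact ⟨j, hj1, hj2⟩
  classical
  set j := Nat.find hex with hj
  obtain ⟨hjJ, hjh⟩ := Nat.find_spec hex
  rw [← hj] at hjJ hjh
  have key := (hq j hjJ).le_aeval_of_not_associated h0 h1 hP hdeg (hna j hjJ) (by
    have t1 := mul_le_mul_of_nonneg_right hDw (hT0 j).le
    have t2 := mul_le_mul_of_nonneg_left (hTmono j hjJ) (show 0 ≤ w by linarith)
    nlinarith)
  refine le_trans (Real.exp_le_exp.mpr ?_) key
  have hW1 : 1 ≤ W := by linarith
  have hTJ := hT0 J
  rcases Nat.eq_or_lt_of_le hjJ with hjJ' | hjJ'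
  · rw [← hjJ']
    nlinarith
  · obtain ⟨i, hi⟩ : ∃ i, j = i + 1 := ⟨j - 1, by omega⟩
    have hmin := Nat.find_min hex (m := i) (by omega)
    have hlt : w / 2 * (l * w ^ i) < h := by
      by_contra hcon
      exact hmin ⟨by omega, not_lt.mp hcon⟩
    have e : l * w ^ j = w * (l * w ^ i) := by rw [hi, pow_succ]; ring
    have t1 : D * (l * w ^ j) ≤ D * (2 * h) :=
      mul_le_mul_of_nonneg_left (by rw [e]; linarith) hD0.le
    have t2 := mul_le_mul_of_nonneg_right hDW hh
    have t3 : 0 ≤ D * (l * w ^ J) := by positivity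
    linarith

/-! ### From inequalities to exponents -/

theorem sSup_coe_eq {S : Set ℝ} {W : ℝ} (hW : 0 < W) (hle : ∀ v ∈ S, v ≤ W)
    (hmem : ∀ v, 0 < v → v < W → v ∈ S) : sSup ((fun w : ℝ => (w : EReal)) '' S) = W := by
  apply le_antisymm
  · apply sSup_le
    rintro _ ⟨v, hv, rfl⟩
    exact EReal.coe_le_coe_iff.mpr (hle v hv)
  · refine le_of_forall_lt fun x hx => ?_
    obtain ⟨v, hxv, hvW⟩ := EReal.lt_iff_exists_real_btwn.mp hx
    have hvW' : v < W := by exact_mod_cast hvW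
    -- The maximum with `W / 2` keeps the witness positive, as `hmem` requires.
    refine hxv.trans (lt_of_lt_of_le ?_ (le_sSup ⟨max ((v + W) / 2) (W / 2), hmem _ ?_ ?_, rfl⟩))
    · exact EReal.coe_lt_coe_iff.mpr (lt_max_of_lt_left (by linarith))
    · exact lt_max_of_lt_right (by linarith)
    · exact max_lt (by linarith) (by linarith)

/-- Heights are not multiplicative, but the Mahler measure is, and the two are comparable in bounded
degree. The induction charges constants to the degree: each nonconstant factor pays `B` at most once
per unit of degree, and constant factors cost nothing. -/
theorem le_abs_aeval_of_irreducible {ξ V C : ℝ} {d : ℕ} (hV : 0 ≤ V) (hC : 0 ≤ C)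
    (h : ∀ P : ℤ[X], Irreducible P → P.natDegree ≤ d →
      Real.exp (-(V * Real.log (polyHeight P) + C)) ≤ |aeval ξ P|) :
    ∃ A : ℝ, ∀ P : ℤ[X], P ≠ 0 → P.natDegree ≤ d →
      Real.exp (-(V * Real.log (polyHeight P) + A)) ≤ |aeval ξ P| := by
  set B := C + V * (d * Real.log 2) with hB
  have hl2 := Real.log_nonneg one_le_two
  have hB0 : 0 ≤ B := by positivity
  have key : ∀ P : ℤ[X], P ≠ 0 → P.natDegree ≤ d →
      Real.exp (-(V * Real.log (intMahler P) + B * P.natDegree)) ≤ |aeval ξ P| := by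
    intro P
    induction P using WfDvdMonoid.induction_on_irreducible with
    | zero => exact fun h0 => absurd rfl h0
    | unit u hu =>
      intro hu0 _
      obtain ⟨r, hr, rfl⟩ := Polynomial.isUnit_iff.mp hu
      have e : |aeval ξ (Polynomial.C r)| = 1 := by
        rcases Int.isUnit_iff.mp hr with rfl | rfl <;> simp
      rw [e, ← Real.exp_zero, Real.exp_le_exp, natDegree_C]
      have := Real.log_nonneg (one_le_intMahler hu0)
      have := mul_nonneg hV this
      simp only [Nat.cast_zero, mul_zero]
      linarith
    | mul Q f hQ hf ih =>
      intro _ hdeg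
      have hf0 := hf.ne_zero
      rw [natDegree_mul hf0 hQ] at hdeg
      have h1 := ih hQ (by omega)
      have h2 : Real.exp (-(V * Real.log (intMahler f) + B * f.natDegree)) ≤ |aeval ξ f| := by
        have hMf := Real.log_nonneg (one_le_intMahler hf0)
        rcases Nat.eq_zero_or_pos f.natDegree with h0 | hpos
        · obtain ⟨r, hr⟩ : ∃ r, f = Polynomial.C r := ⟨_, eq_C_of_natDegree_eq_zero h0⟩
          have hr0 : r ≠ 0 := by
            rintro rfl
            simp [hr] at hf0
          have e : 1 ≤ |aeval ξ f| := by
            rw [hr, aeval_C, eq_intCast]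
            exact_mod_cast Int.one_le_abs hr0
          refine le_trans ?_ e
          rw [← Real.exp_zero, Real.exp_le_exp]
          have := mul_nonneg hV hMf
          rw [h0, Nat.cast_zero]
          linarith
        · refine le_trans (Real.exp_le_exp.mpr ?_) (h f hf (by omega))
          have hH := one_le_polyHeight hf0
          have hM := one_le_intMahler hf0
          have hle : Real.log (polyHeight f) ≤ d * Real.log 2 + Real.log (intMahler f) := by
            rw [← Real.log_pow, ← Real.log_mul (by positivity) (by positivity)]
            exact Real.log_le_log (by positivity) (polyHeight_le_intMahler (by omega))
          have hp : (1 : ℝ) ≤ f.natDegree := by exact_mod_cast hpos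
          have t1 := mul_le_mul_of_nonneg_left hle hV
          have t2 := mul_le_mul_of_nonneg_left hp hB0
          linarith
      rw [natDegree_mul hf0 hQ, intMahler_mul, map_mul, abs_mul,
        Real.log_mul (by linarith [one_le_intMahler hf0]) (by linarith [one_le_intMahler hQ])]
      refine le_trans (le_of_eq ?_) (mul_le_mul h2 h1 (Real.exp_pos _).le (abs_nonneg _))
      rw [← Real.exp_add]
      congr 1
      push_cast
      ring
  refine ⟨V * Real.log (d + 1) + B * d, fun P hP hdeg => ?_⟩
  refine le_trans (Real.exp_le_exp.mpr ?_) (key P hP hdeg)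
  have hH := one_le_polyHeight hP
  have hM := one_le_intMahler hP
  have hle : Real.log (intMahler P) ≤ Real.log (d + 1) + Real.log (polyHeight P) := by
    rw [← Real.log_mul (by positivity) (by positivity)]
    exact Real.log_le_log (by positivity) (intMahler_le hdeg)
  have hp : (P.natDegree : ℝ) ≤ d := by exact_mod_cast hdeg
  have t1 := mul_le_mul_of_nonneg_left hle hV
  have t2 := mul_le_mul_of_nonneg_left hp hB0
  linarith

theorem rpow_polyHeight {P : ℤ[X]} (hP : P ≠ 0) (v : ℝ) :
    (polyHeight P : ℝ) ^ v = Real.exp (Real.log (polyHeight P) * v) :=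
  Real.rpow_def_of_pos (by linarith [one_le_polyHeight hP]) v

theorem not_infinite_of_le_aeval {ξ V A v : ℝ} {n d : ℕ} (hnd : n ≤ d) (hVv : V < v)
    (h : ∀ P : ℤ[X], P ≠ 0 → P.natDegree ≤ d →
      Real.exp (-(V * Real.log (polyHeight P) + A)) ≤ |aeval ξ P|) :
    ¬Set.Infinite {P : ℤ[X] | P.natDegree ≤ n ∧
      0 < |aeval ξ P| ∧ |aeval ξ P| ≤ (polyHeight P : ℝ) ^ (-v)} := by
  rw [Set.not_infinite]
  refine (finite_polyHeight_le n (Real.exp (A / (v - V)))).subset ?_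
  rintro P ⟨hdeg, hpos, hle⟩
  refine ⟨hdeg, ?_⟩
  have hP : P ≠ 0 := by
    rintro rfl
    simp at hpos
  have hH := one_le_polyHeight hP
  rw [rpow_polyHeight hP] at hle
  have := Real.exp_le_exp.mp ((h P hP (hdeg.trans hnd)).trans hle)
  rw [← Real.log_le_iff_le_exp (by linarith), le_div_iff₀ (by linarith)]
  linarith

theorem not_infinite_of_le_dist {ξ V A v : ℝ} {n d : ℕ} (hnd : n ≤ d) (hVv : V < v)
    (h : ∀ α : ℂ, IsAlgebraic ℚ α → (minpoly ℚ α).natDegree ≤ d →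
      0 < ‖(ξ : ℂ) - α‖ → Real.exp (-((V + 1) * Real.log (algHeight α) + A)) ≤ ‖(ξ : ℂ) - α‖) :
    ¬Set.Infinite {α : ℂ | IsAlgebraic ℚ α ∧ (minpoly ℚ α).natDegree ≤ n ∧
      0 < ‖(ξ : ℂ) - α‖ ∧ ‖(ξ : ℂ) - α‖ ≤ (algHeight α : ℝ) ^ (-v - 1)} := by
  rw [Set.not_infinite]
  refine ((finite_polyHeight_le n (Real.exp (A / (v - V)))).biUnion
    fun P _ => P.rootSet_finite ℂ).subset ?_
  rintro α ⟨halg, hdeg, hpos, hle⟩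
  have hP := intMinpoly_ne_zero halg
  have hH := one_le_polyHeight hP
  simp only [Set.mem_iUnion]
  refine ⟨intMinpoly α, ⟨(natDegree_intMinpoly halg).trans_le hdeg, ?_⟩,
    (mem_rootSet.mpr ⟨hP, aeval_intMinpoly halg⟩)⟩
  have h1 := h α halg (hdeg.trans hnd) hpos
  unfold algHeight at h1 hle
  rw [rpow_polyHeight hP] at hle
  have := Real.exp_le_exp.mp (h1.trans hle)
  rw [← Real.log_le_iff_le_exp (by linarith), le_div_iff₀ (by linarith)]
  linarith

theorem infinite_of_unbounded {β : Type*} {S : Set β} (H : β → ℝ)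
    (h : ∀ N : ℝ, ∃ x ∈ S, N ≤ H x) : S.Infinite := by
  intro hfin
  obtain ⟨M, hM⟩ := (hfin.image H).bddAbove
  obtain ⟨x, hx, hxM⟩ := h (M + 1)
  have := hM ⟨x, hx, rfl⟩
  linarith

theorem IsQuadApprox.log_height {ξ w η T E α : ℝ} (hq : IsQuadApprox ξ w η T E α) :
    (2 + η) * T - E ≤ Real.log (polyHeight (intMinpoly (α : ℂ))) ∧
      Real.log (polyHeight (intMinpoly (α : ℂ))) ≤ (2 + η) * T + E := by
  have hH : (0 : ℝ) < polyHeight (intMinpoly (α : ℂ)) := by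
    linarith [one_le_polyHeight (intMinpoly_ne_zero hq.isAlgebraic)]
  exact ⟨(Real.le_log_iff_exp_le hH).mpr hq.le_height, (Real.log_le_iff_le_exp hH).mpr hq.height_le⟩

/-- The distance from `ξ` to any root of the minimal polynomial of a quadratic approximation. -/
theorem IsQuadApprox.le_dist_root {ξ w η T E α : ℝ} (hq : IsQuadApprox ξ w η T E α)
    (hE : 2 * T + 2 * E ≤ 2 * w * T) {β : ℂ} (hβ : aeval β (intMinpoly (α : ℂ)) = 0) :
    Real.exp (-(2 * w) * T - E) ≤ ‖(ξ : ℂ) - β‖ := by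
  have hnorm : ‖(ξ : ℂ) - α‖ = |ξ - α| := by
    rw [← Complex.ofReal_sub, Complex.norm_real, Real.norm_eq_abs]
  set f := intMinpoly (α : ℂ) with hf
  have hinj : Function.Injective (Int.castRingHom ℂ) := RingHom.injective_int _
  set F := f.map (Int.castRingHom ℂ) with hF
  have hf0 : f ≠ 0 := intMinpoly_ne_zero hq.isAlgebraic
  have hFdeg : F.natDegree = 2 := by rw [hF, natDegree_map_eq_of_injective hinj, hq.natDegree_eq]
  have hF0 : F ≠ 0 := fun h0 => by rw [h0] at hFdeg; simp at hFdeg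
  have ev : ∀ z : ℂ, eval z F = aeval z f := fun z => by rw [hF, eval_map]; rfl
  have hαF : (α : ℂ) ∈ F.roots := by
    rw [mem_roots hF0, IsRoot.def, ev]
    exact aeval_intMinpoly hq.isAlgebraic
  have hβF : β ∈ F.roots := by
    rw [mem_roots hF0, IsRoot.def, ev]
    exact hβ
  obtain ⟨γ, hroots⟩ := exists_roots_eq_pair hFdeg hαF
  rw [hroots] at hβF
  have hfac : ‖aeval (ξ : ℂ) f‖ = ‖F.leadingCoeff‖ * (‖(ξ : ℂ) - α‖ * ‖(ξ : ℂ) - γ‖) := by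
    rw [← ev, (IsAlgClosed.splits F).eval_eq_prod_roots, hroots]
    simp
  have hlead : ‖F.leadingCoeff‖ ≤ polyHeight f := by
    rw [hF, leadingCoeff_map_of_injective hinj, eq_intCast, Complex.norm_intCast]
    exact abs_coeff_le_polyHeight f _
  rcases Multiset.mem_cons.mp hβF with rfl | hβγ
  · rw [hnorm]
    exact hq.le_dist
  · rw [Multiset.mem_singleton.mp hβγ]
    rw [norm_aeval_ofReal, hnorm] at hfac
    have h1 := hq.le_aeval
    rw [← hf, hfac] at h1
    have h2 : Real.exp (-(2 * w - η) * T - E) ≤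
        Real.exp ((2 + η) * T + E) * (Real.exp (-(2 * w) * T + E) * ‖(ξ : ℂ) - γ‖) := by
      refine h1.trans ?_
      have := hlead.trans hq.height_le
      have := hq.dist_le
      gcongr
    -- The outcome is `exp (-2 T - 3 E)` as a lower bound for the distance to the other root, and
    -- `hE` makes this sufficient.
    rw [← mul_assoc, ← Real.exp_add, ← div_le_iff₀' (Real.exp_pos _), ← Real.exp_sub] at h2
    refine le_trans (Real.exp_le_exp.mpr ?_) h2
    linarith

theorem Associated.polyHeight_eq {P Q : ℤ[X]} (h : Associated P Q) :
    polyHeight P = polyHeight Q := by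
  rcases h.eq_or_eq_neg_of_int with rfl | rfl
  · rfl
  · exact polyHeight_congr fun i => by simp

theorem Associated.abs_aeval_eq {P Q : ℤ[X]} (h : Associated P Q) (ξ : ℝ) :
    |aeval ξ P| = |aeval ξ Q| := by
  rcases h.eq_or_eq_neg_of_int with rfl | rfl <;> simp

/-! ### Computation of the two exponents -/

section Exponents

variable {ξ w η l : ℝ} {d : ℕ}

theorem exists_approx_sequence (hw : 1 < w) (hl : 0 < l)
    (hq : ∀ ε : ℝ, 0 < ε → ∀ᶠ j : ℕ in atTop, ∃ α : ℝ,
      IsQuadApprox ξ w η (l * w ^ j) (ε * (l * w ^ j)) α) {ε : ℝ} (hε : 0 < ε) (N : ℝ) :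
    ∃ (α : ℕ → ℝ) (J : ℕ), (∀ j ≥ J, IsQuadApprox ξ w η (l * w ^ j) (ε * (l * w ^ j)) (α j)) ∧
      N ≤ l * w ^ J := by
  classical
  have ht : Tendsto (fun j : ℕ => l * w ^ j) atTop atTop :=
    (tendsto_pow_atTop_atTop_of_one_lt hw).const_mul_atTop hl
  obtain ⟨J, hJ⟩ := eventually_atTop.mp ((hq ε hε).and (ht.eventually_ge_atTop N))
  exact ⟨fun j => if h : J ≤ j then (hJ j h).1.choose else 0, J, fun j hj => by
    simp only [ge_iff_le.mp hj, dite_true]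
    exact (hJ j hj).1.choose_spec, (hJ J le_rfl).2⟩

theorem exists_small (p : ℝ) {q : ℝ} (hq : 0 < q) : ∃ ε : ℝ, 0 < ε ∧ ε ≤ 1 / 4 ∧ ε * p ≤ q := by
  refine ⟨min (1 / 4) (q / (|p| + 1)), by positivity, min_le_left _ _, ?_⟩
  have h0 : 0 ≤ min (1 / 4) (q / (|p| + 1)) := by positivity
  calc _ ≤ min (1 / 4) (q / (|p| + 1)) * (|p| + 1) := by
        gcongr
        linarith [le_abs_self p]
    _ ≤ q / (|p| + 1) * (|p| + 1) := by
        gcongr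
        exact min_le_right _ _
    _ = q := by field_simp

theorem exists_le_aeval (h0 : 0 ≤ ξ) (h1 : ξ ≤ 1)
    (hl : 0 < l) (hη : 0 < η) (hd : 2 ≤ d) (hdw : d * (2 + η) ^ 2 ≤ 7 / 10 * w) (hw : 11 ≤ w)
    (hq : ∀ ε : ℝ, 0 < ε → ∀ᶠ j : ℕ in atTop, ∃ α : ℝ,
      IsQuadApprox ξ w η (l * w ^ j) (ε * (l * w ^ j)) α)
    {V : ℝ} (hV : (2 * w - η) / (2 + η) < V) :
    ∃ A : ℝ, ∀ P : ℤ[X], P ≠ 0 → P.natDegree ≤ d →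
      Real.exp (-(V * Real.log (polyHeight P) + A)) ≤ |aeval ξ P| := by
  have hWV : (2 * w - 2 - η) / (2 + η) ≤ V := le_trans (by gcongr; linarith) hV.le
  rw [div_lt_iff₀ (by linarith)] at hV
  -- The factor `V + 1` collects the error `ε` from the height, taken `V` times, and once from the
  -- value at `ξ`.
  obtain ⟨ε, hε, hε4, hεV⟩ := exists_small (V + 1) (sub_pos.mpr hV)
  obtain ⟨α, J, hα, hJ⟩ := exists_approx_sequence (by linarith) hl hq hε
    (2 * (Real.log (d + 1) + d * Real.log 3 + Real.log (lipConst d) + Real.log 2) / w)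
  rw [div_le_iff₀ (by linarith), mul_comm (l * w ^ J)] at hJ
  obtain ⟨A, hA0, hA⟩ := exists_le_aeval_of_not_associated h0 h1 hl hη hd hdw hw hε hε4 hα hJ
  have hdη : 2 + η ≤ 7 / 40 * w := by
    have : (2 : ℝ) ≤ d := by exact_mod_cast hd
    nlinarith
  have hV0 : 0 ≤ V := le_trans (div_nonneg (by linarith) (by linarith)) hWV
  refine le_abs_aeval_of_irreducible hV0 hA0 fun P hP hdeg => ?_
  have hh := Real.log_nonneg (one_le_polyHeight hP.ne_zero)
  by_cases hna : ∀ j ≥ J, ¬Associated (intMinpoly (α j : ℂ)) P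
  · refine le_trans (Real.exp_le_exp.mpr ?_) (hA P hP hdeg hna)
    have := mul_le_mul_of_nonneg_right hWV hh
    linarith
  · push Not at hna
    obtain ⟨j, hj, has⟩ := hna
    have hT : 0 < l * w ^ j := by positivity
    rw [← has.polyHeight_eq, ← has.abs_aeval_eq]
    refine le_trans (Real.exp_le_exp.mpr ?_) (hα j hj).le_aeval
    have t1 := mul_le_mul_of_nonneg_left (hα j hj).log_height.1 hV0
    have t2 := mul_le_mul_of_nonneg_right hεV hT.le
    nlinarith

theorem exists_le_dist (h0 : 0 ≤ ξ) (h1 : ξ ≤ 1)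
    (hl : 0 < l) (hη : 0 < η) (hd : 2 ≤ d) (hdw : d * (2 + η) ^ 2 ≤ 7 / 10 * w) (hw : 11 ≤ w)
    (hq : ∀ ε : ℝ, 0 < ε → ∀ᶠ j : ℕ in atTop, ∃ α : ℝ,
      IsQuadApprox ξ w η (l * w ^ j) (ε * (l * w ^ j)) α)
    {V : ℝ} (hV : (2 * w - 2 - η) / (2 + η) < V) :
    ∃ A : ℝ, ∀ α : ℂ, IsAlgebraic ℚ α → (minpoly ℚ α).natDegree ≤ d → 0 < ‖(ξ : ℂ) - α‖ →
      Real.exp (-((V + 1) * Real.log (algHeight α) + A)) ≤ ‖(ξ : ℂ) - α‖ := by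
  have hWV := hV.le
  rw [div_lt_iff₀ (by linarith)] at hV
  obtain ⟨ε, hε, hε4, hεV⟩ := exists_small (V + 2) (sub_pos.mpr hV)
  obtain ⟨α, J, hα, hJ⟩ := exists_approx_sequence (by linarith) hl hq hε
    (2 * (Real.log (d + 1) + d * Real.log 3 + Real.log (lipConst d) + Real.log 2) / w)
  rw [div_le_iff₀ (by linarith), mul_comm (l * w ^ J)] at hJ
  obtain ⟨A, hA0, hA⟩ := exists_le_aeval_of_not_associated h0 h1 hl hη hd hdw hw hε hε4 hα hJ
  have hdη : 2 + η ≤ 7 / 40 * w := by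
    have : (2 : ℝ) ≤ d := by exact_mod_cast hd
    nlinarith
  have hV0 : 0 ≤ V := le_trans (div_nonneg (by linarith) (by linarith)) hWV
  have hlip : 0 ≤ Real.log (lipConst d) := Real.log_nonneg (by
    unfold lipConst
    have : (0 : ℝ) ≤ (d + 1) * (d * 2 ^ d) := by positivity
    linarith)
  refine ⟨A + Real.log (lipConst d), fun β hβ hdeg _ => ?_⟩
  have hirr := irreducible_intMinpoly hβ
  have hH := one_le_polyHeight hirr.ne_zero
  have hh := Real.log_nonneg hH
  unfold algHeight
  by_cases hna : ∀ j ≥ J, ¬Associated (intMinpoly (α j : ℂ)) (intMinpoly β)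
  -- Near `ξ` the root `β` lies in the disc of radius `2`, so the Lipschitz bound turns the lower
  -- bound for the polynomial value into one for the distance and lowers the exponent's counterpart
  -- `V + 1` to the `W` of the value. Far away there is nothing to prove.
  · rcases le_or_gt ‖(ξ : ℂ) - β‖ 1 with hle | hgt
    · have key := hA _ hirr ((natDegree_intMinpoly hβ).trans_le hdeg) hna
      have n1 : ‖(ξ : ℂ)‖ ≤ 1 := by
        rw [Complex.norm_real, Real.norm_eq_abs, abs_of_nonneg h0]; exact h1
      have n2 : ‖β‖ ≤ 2 := by
        have := norm_sub_le (ξ : ℂ) ((ξ : ℂ) - β)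
        rw [sub_sub_cancel] at this
        linarith
      have hl := norm_aeval_sub_le ((natDegree_intMinpoly hβ).trans_le hdeg)
        (n1.trans one_le_two) n2
      rw [aeval_intMinpoly hβ, sub_zero, norm_aeval_ofReal] at hl
      have h2 := key.trans hl
      rw [← Real.exp_log (lipConst_pos d), ← Real.exp_log (show (0 : ℝ) <
        polyHeight (intMinpoly β) by linarith), ← Real.exp_add, ← div_le_iff₀' (Real.exp_pos _),
        ← Real.exp_sub, Real.log_exp] at h2
      refine le_trans (Real.exp_le_exp.mpr ?_) h2
      have := mul_le_mul_of_nonneg_right hWV hh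
      linarith
    · refine le_trans ?_ hgt.le
      rw [Real.exp_le_one_iff]
      have : 0 ≤ (V + 1) * Real.log (polyHeight (intMinpoly β)) := by positivity
      linarith
  · push Not at hna
    obtain ⟨j, hj, has⟩ := hna
    have hT : 0 < l * w ^ j := by positivity
    obtain ⟨q, hq⟩ := has.symm.dvd
    have hroot : aeval β (intMinpoly (α j : ℂ)) = 0 := by
      rw [hq, map_mul, aeval_intMinpoly hβ, zero_mul]
    rw [← has.polyHeight_eq]
    refine le_trans (Real.exp_le_exp.mpr ?_) ((hα j hj).le_dist_root (by nlinarith) hroot)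
    have t1 := mul_le_mul_of_nonneg_left (hα j hj).log_height.1 (show 0 ≤ V + 1 by linarith)
    have t2 := mul_le_mul_of_nonneg_right hεV hT.le
    nlinarith

theorem wExp_eq (h0 : 0 ≤ ξ) (h1 : ξ ≤ 1)
    (hl : 0 < l) (hη : 0 < η) (hd : 2 ≤ d) (hdw : d * (2 + η) ^ 2 ≤ 7 / 10 * w) (hw : 11 ≤ w)
    (hq : ∀ ε : ℝ, 0 < ε → ∀ᶠ j : ℕ in atTop, ∃ α : ℝ,
      IsQuadApprox ξ w η (l * w ^ j) (ε * (l * w ^ j)) α) {n : ℕ} (hn : 2 ≤ n) (hnd : n ≤ d) :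
    wExp n ξ = (((2 * w - η) / (2 + η) : ℝ) : EReal) := by
  have hdη : 2 + η ≤ 7 / 40 * w := by
    have : (2 : ℝ) ≤ d := by exact_mod_cast hd
    nlinarith
  refine sSup_coe_eq (div_pos (by linarith) (by linarith)) (fun v hv => ?_) fun v hv hvW => ?_
  · by_contra hlt
    rw [not_le] at hlt
    obtain ⟨V, hV1, hV2⟩ := exists_between hlt
    obtain ⟨A, hA⟩ := exists_le_aeval h0 h1 hl hη hd hdw hw hq hV1
    exact not_infinite_of_le_aeval hnd hV2 hA hv
  · rw [lt_div_iff₀ (by linarith)] at hvW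
    obtain ⟨ε, hε, hε4, hεv⟩ := exists_small (v + 1) (sub_pos.mpr hvW)
    refine infinite_of_unbounded (fun P => (polyHeight P : ℝ)) fun N => ?_
    obtain ⟨α, J, hα, hJ⟩ := exists_approx_sequence (by linarith) hl hq hε N
    have hα := hα J le_rfl
    have hP := intMinpoly_ne_zero hα.isAlgebraic
    have hT : 0 < l * w ^ J := by positivity
    refine ⟨intMinpoly (α J : ℂ), ⟨hα.natDegree_eq.trans_le hn,
      (Real.exp_pos _).trans_le hα.le_aeval, ?_⟩, ?_⟩
    · rw [rpow_polyHeight hP]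
      refine hα.aeval_le.trans (Real.exp_le_exp.mpr ?_)
      have t1 := mul_le_mul_of_nonneg_left hα.log_height.2 hv.le
      have t2 := mul_le_mul_of_nonneg_right hεv hT.le
      nlinarith
    · refine le_trans ?_ hα.le_height
      refine hJ.trans (le_trans ?_ (Real.add_one_le_exp _))
      nlinarith

theorem wStarExp_eq (h0 : 0 ≤ ξ) (h1 : ξ ≤ 1)
    (hl : 0 < l) (hη : 0 < η) (hd : 2 ≤ d) (hdw : d * (2 + η) ^ 2 ≤ 7 / 10 * w) (hw : 11 ≤ w)
    (hq : ∀ ε : ℝ, 0 < ε → ∀ᶠ j : ℕ in atTop, ∃ α : ℝ,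
      IsQuadApprox ξ w η (l * w ^ j) (ε * (l * w ^ j)) α) {n : ℕ} (hn : 2 ≤ n) (hnd : n ≤ d) :
    wStarExp n ξ = (((2 * w - 2 - η) / (2 + η) : ℝ) : EReal) := by
  have hdη : 2 + η ≤ 7 / 40 * w := by
    have : (2 : ℝ) ≤ d := by exact_mod_cast hd
    nlinarith
  refine sSup_coe_eq (div_pos (by linarith) (by linarith)) (fun v hv => ?_) fun v hv hvW => ?_
  · by_contra hlt
    rw [not_le] at hlt
    obtain ⟨V, hV1, hV2⟩ := exists_between hlt
    obtain ⟨A, hA⟩ := exists_le_dist h0 h1 hl hη hd hdw hw hq hV1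
    exact not_infinite_of_le_dist hnd hV2 hA hv
  · rw [lt_div_iff₀ (by linarith)] at hvW
    obtain ⟨ε, hε, hε4, hεv⟩ := exists_small (v + 2) (sub_pos.mpr hvW)
    refine infinite_of_unbounded (fun α => (algHeight α : ℝ)) fun N => ?_
    obtain ⟨α, J, hα, hJ⟩ := exists_approx_sequence (by linarith) hl hq hε N
    have hα := hα J le_rfl
    have hP := intMinpoly_ne_zero hα.isAlgebraic
    have hT : 0 < l * w ^ J := by positivity
    have hnorm : ‖(ξ : ℂ) - α J‖ = |ξ - α J| := by
      rw [← Complex.ofReal_sub, Complex.norm_real, Real.norm_eq_abs]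
    refine ⟨(α J : ℂ), ⟨hα.isAlgebraic, ?_, ?_, ?_⟩, ?_⟩
    · rw [← natDegree_intMinpoly hα.isAlgebraic, hα.natDegree_eq]
      exact hn
    · rw [hnorm]
      exact (Real.exp_pos _).trans_le hα.le_dist
    · unfold algHeight
      rw [rpow_polyHeight hP, hnorm]
      refine hα.dist_le.trans (Real.exp_le_exp.mpr ?_)
      have t1 := mul_le_mul_of_nonneg_left hα.log_height.2 (show 0 ≤ v + 1 by linarith)
      have t2 := mul_le_mul_of_nonneg_right hεv hT.le
      nlinarith
    · refine le_trans ?_ hα.le_height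
      refine hJ.trans (le_trans ?_ (Real.add_one_le_exp _))
      nlinarith

end Exponents

/-! ### The numerical condition and the conclusion -/

/-- With `t = √w ≥ 11 d ≥ 22` and `η d < t`, the terms `d η ^ 2`, `4 d η` and `4 d` are at most `t ^
2 / 2`, `2 t ^ 2 / 11` and `2 t ^ 2 / 121`, which sum to just under `7 / 10 * w`. -/
theorem mul_two_add_sq_le {d : ℕ} (hd : 2 ≤ d) {w η : ℝ} (hw : 121 * (d : ℝ) ^ 2 ≤ w)
    (hη : 0 < η) (hη' : η < Real.sqrt w / d) : d * (2 + η) ^ 2 ≤ 7 / 10 * w := by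
  have hd2 : (2 : ℝ) ≤ d := by exact_mod_cast hd
  have hw0 : 0 ≤ w := le_trans (by positivity) hw
  have hsq := Real.sq_sqrt hw0
  have ht : 11 * (d : ℝ) ≤ √w := Real.le_sqrt_of_sq_le (by linarith)
  rw [lt_div_iff₀ (by linarith)] at hη'
  set t := √w
  have h1 : η * (η * d) ≤ t / 2 * t := by
    have : η ≤ t / 2 := by nlinarith
    gcongr
  nlinarith

theorem mainTheorem10 (d : ℕ) (hd : 2 ≤ d) (w : ℝ) (hw : 121 * (d : ℝ) ^ 2 ≤ w)
    (a b c : ℕ) (ha : 0 < a) (hb : 0 < b) (hc : 0 < c) (hab : a ≠ b) (hac : a ≠ c) (hbc : b ≠ c)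
    (η : ℝ) (hη : 0 < η) (hη' : η < Real.sqrt w / d) :
    ∃ ξ : ℝ, Tendsto (fun k : ℕ => (simpleCF (partQuot w η a b c)).convs k) atTop (𝓝 ξ) ∧
      ∀ n : ℕ, 2 ≤ n → n ≤ d →
        wStarExp n ξ = (((2 * w - 2 - η) / (2 + η) : ℝ) : EReal) ∧
        wExp n ξ = (((2 * w - η) / (2 + η) : ℝ) : EReal) ∧
        wExp n ξ - wStarExp n ξ = ((2 / (2 + η) : ℝ) : EReal) := by
  have hd2 : (2 : ℝ) ≤ d := by exact_mod_cast hd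
  have hdw := mul_two_add_sq_le hd hw hη hη'
  have hw11 : 11 ≤ w := by nlinarith
  have hηw : 1 + 2 * η < w := by nlinarith
  have hx := partQuot_pos (w := w) (η := η) ha hb hc
  obtain ⟨l, hl, hq⟩ := exists_isQuadApprox (by linarith) hη hηw ha hb hc hab hac hbc
  refine ⟨cfVal (partQuot w η a b c), tendsto_convs_simpleCF hx, fun n hn hnd => ?_⟩
  have e1 := wStarExp_eq (cfVal_nonneg hx) (cfVal_le_one hx) hl hη hd hdw hw11 hq hn hnd
  have e2 := wExp_eq (cfVal_nonneg hx) (cfVal_le_one hx) hl hη hd hdw hw11 hq hn hnd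
  refine ⟨e1, e2, ?_⟩
  rw [e1, e2, ← EReal.coe_sub]
  congr 1
  field_simp
  ring
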